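/- **Setting.** Let $M=\mathbb R\times S^1$ with $S^1=\mathbb R/\mathbb Z$, coordinates $(t,\theta)$ and metric $-dt\otimes dt+d\theta\otimes d\theta$, with the Hodge operator on one-forms fixed by $*dt=-d\theta$, $*d\theta=-dt$. Let $\mathcal S=dC^\infty(M)\cap *dC^\infty(M)$ be the real vector space of one-forms $\eta$ that can be written as $\eta=d\varphi=*d\tilde\varphi$ with smooth real functions $\varphi,\tilde\varphi$ on $M$, and let $$\tau(d\varphi=*d\tilde\varphi,\;d\varphi'=*d\tilde\varphi')=\int_{\{0\}\times S^1}\tilde\varphi\,d\varphi'+\varphi\,d\tilde\varphi'\in\mathbb R .$$ Up to additive constants, $$\varphi=\sum_{k\ge1}\bigl(-b_k^-\cos 2\pi k(t-\theta)-b_k^+\cos 2\pi k(t+\theta)+a_k^-\sin 2\pi k(t-\theta)+a_k^+\sin 2\pi k(t+\theta)\bigr),$$ $$\tilde\varphi=\sum_{k\ge1}\bigl(-b_k^-\cos 2\pi k(t-\theta)+b_k^+\cos 2\pi k(t+\theta)+a_k^-\sin 2\pi k(t-\theta)-a_k^+\sin 2\pi k(t+\theta)\bigr).$$ Put $$\mu(d\varphi,d\varphi')=\sum_{k\ge1}\pi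 k\,\bigl(a_k^+a_k^{+\prime}+b_k^+b_k^{+\prime}+a_k^-a_k^{-\prime}+b_k^-b_k^{-\prime}\bigr).$$ For $\kappa\in\mathbb R$ let $\mathcal A_\kappa$ be the Weyl $C^*$-algebra of $(\mathcal S,\kappa\tau \bmod \mathbb Z)$: the completion of the linear span of symbols $\mathcal W(\eta)$, $\eta\in\mathcal S$, with $$\mathcal W(\eta)\mathcal W(\eta')=e^{2\pi i\kappa\tau(\eta,\eta')}\,\mathcal W(\eta+\eta'),\qquad \mathcal W(\eta)^*=\mathcal W(-\eta),$$ in the norm $\|a\|=\sup_\omega\sqrt{\omega(a^*a)}$, the supremum being taken over all states $\omega$. Let $\zeta$ (the duality) and $\alpha_{(s,\phi)}$, $(s,\phi)\in\mathbb R\times\mathbb T$ (the spacetime symmetries), be the $*$-automorphisms of $\mathcal A_\kappa$ with $$\zeta\,\mathcal W(d\varphi=*d\tilde\varphi)=\mathcal W(d\tilde\varphi=*d\varphi),\qquad \alpha_{(s,\phi)}\,\mathcal W(\eta)=\mathcal W\bigl(\eta(\cdot+s,\cdot+\phi)\bigr).$$ **Theorem.** Let $\kappa,r\in\mathbb R$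 with $r\ge 4\pi|\kappa|$. There is exactly one state $\omega_\mu$ on $\mathcal A_\kappa$ with $$\omega_\mu(\mathcal W(\eta))=e^{-\frac r2\mu(\eta,\eta)}\qquad\text{for all }\eta\in\mathcal S .$$ Let $(\mathcal H,\pi,\Psi)$ be a GNS triple of $\omega_\mu$, that is, a representation $\pi$ of $\mathcal A_\kappa$ on a Hilbert space $\mathcal H$ with a cyclic vector $\Psi$ such that $\langle\Psi,\pi(a)\Psi\rangle=\omega_\mu(a)$ for all $a\in\mathcal A_\kappa$. Then the duality and the spacetime symmetries are implemented on $\mathcal H$ by unitary operators: there are a unitary operator $V$ on $\mathcal H$ and a group homomorphism $(s,\phi)\mapsto U_{(s,\phi)}$ from $\mathbb R\times\mathbb T$ to the unitary operators on $\mathcal H$ such that, for all $a\in\mathcal A_\kappa$ and all $(s,\phi)$, $$V\pi(a)\Psi=\pi(\zeta a)\Psi,\quad V\pi(a)=\pi(\zeta a)V,\qquad U_{(s,\phi)}\pi(a)\Psi=\pi(\alpha_{(s,\phi)}a)\Psi,\quad U_{(s,\phi)}\pi(a)=\pi(\alpha_{(s,\phi)}a)U_{(s,\phi)} .$$ Furthermore,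 these operators commute: $VU_{(s,\phi)}=U_{(s,\phi)}V$ for all $(s,\phi)\in\mathbb R\times\mathbb T$. (The choice $\kappa=1$ gives the Weyl relations $\mathcal W(\eta)\mathcal W(\eta')=e^{2\pi i\tau(\eta,\eta')}\mathcal W(\eta+\eta')$, with $r=4\pi$ as smallest admissible constant; the choice $\kappa=-\tfrac1{4\pi}$, $r=1$ gives $\mathcal W(\eta)\mathcal W(\eta')=e^{-\frac i2\tau(\eta,\eta')}\mathcal W(\eta+\eta')$ and $\omega_\mu(\mathcal W(\eta))=e^{-\frac12\mu(\eta,\eta)}$.) -/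

import Mathlib

noncomputable section

/-- A pre-symplectic form `τ` on an Abelian group: biadditive and alternating (hence
antisymmetric), with values in `𝕋 = ℝ/ℤ`. -/
structure PresymplecticForm (G : Type*) [AddCommGroup G] where
  toHom : G →+ G →+ UnitAddCircle
  self_eq_zero : ∀ x, toHom x x = 0

namespace PresymplecticForm

variable {G : Type*} [AddCommGroup G] (τ : PresymplecticForm G)

theorem antisymm (x y : G) : τ.toHom y x = -τ.toHom x y := by
  have h := τ.self_eq_zero (x + y)
  simp only [map_add, AddMonoidHom.add_apply, τ.self_eq_zero, zero_add, add_zero] at h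
  exact eq_neg_of_add_eq_zero_left h

/-- The phase `exp (2πi τ(x, y))`. -/
def phase (x y : G) : ℂ := (AddCircle.toCircle (τ.toHom x y) : ℂ)

theorem phase_add_left (x y z : G) : τ.phase (x + y) z = τ.phase x z * τ.phase y z := by
  simp [phase, AddCircle.toCircle_add]

theorem phase_add_right (x y z : G) : τ.phase x (y + z) = τ.phase x y * τ.phase x z := by
  simp [phase, AddCircle.toCircle_add]

theorem phase_zero_left (x : G) : τ.phase 0 x = 1 := by simp [phase]

theorem phase_zero_right (x : G) : τ.phase x 0 = 1 := by simp [phase]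

theorem phase_neg_self (x : G) : τ.phase (-x) x = 1 := by simp [phase, τ.self_eq_zero]

theorem phase_star (x y : G) : τ.phase (-y) (-x) = star (τ.phase x y) := by
  rw [phase, phase, map_neg, map_neg, AddMonoidHom.neg_apply, neg_neg, τ.antisymm x y,
    AddCircle.toCircle_neg, Circle.coe_inv_eq_conj]
  rfl

end PresymplecticForm

/-- The complex vector space spanned by the symbols `W(x)`, `x ∈ G`, made below into a unital
⋆-algebra by `W(x) W(y) = exp (2πi τ(x, y)) W(x + y)`, `1 = W(0)` and `W(x)⋆ = W(-x)`. -/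
def WeylAlg {G : Type*} [AddCommGroup G] (_τ : PresymplecticForm G) : Type _ := G →₀ ℂ

namespace WeylAlg

variable {G : Type*} [AddCommGroup G] {τ : PresymplecticForm G}

instance : AddCommGroup (WeylAlg τ) := inferInstanceAs (AddCommGroup (G →₀ ℂ))
instance : Module ℂ (WeylAlg τ) := inferInstanceAs (Module ℂ (G →₀ ℂ))

/-- The generator `W(x)`. -/
def W (τ : PresymplecticForm G) (x : G) : WeylAlg τ := Finsupp.single x (1 : ℂ)

/-- Linear extension of a map on generators. -/
def lift {M : Type*} [AddCommGroup M] [Module ℂ M] (v : G → M) : WeylAlg τ →ₗ[ℂ] M :=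
  Finsupp.linearCombination ℂ v

theorem lift_W {M : Type*} [AddCommGroup M] [Module ℂ M] (v : G → M) (x : G) :
    (lift v : WeylAlg τ →ₗ[ℂ] M) (W τ x) = v x := by
  exact (Finsupp.linearCombination_single ℂ (1 : ℂ) x).trans (one_smul ℂ (v x))

theorem induction {p : WeylAlg τ → Prop} (h0 : p 0) (hadd : ∀ a b, p a → p b → p (a + b))
    (hW : ∀ (c : ℂ) (x : G), p (c • W τ x)) (a : WeylAlg τ) : p a := by
  refine Finsupp.induction_linear a h0 hadd fun x c => ?_
  have : (Finsupp.single x c : G →₀ ℂ) = c • Finsupp.single x (1 : ℂ) := by simp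
  exact this ▸ hW c x

/-- The bilinear product with `W(x) W(y) = exp (2πi τ(x, y)) W(x + y)`. -/
def mulMap : WeylAlg τ →ₗ[ℂ] WeylAlg τ →ₗ[ℂ] WeylAlg τ :=
  lift fun x => lift fun y => τ.phase x y • W τ (x + y)

instance : Mul (WeylAlg τ) := ⟨fun a b => mulMap a b⟩
instance : One (WeylAlg τ) := ⟨W τ 0⟩

theorem mul_def (a b : WeylAlg τ) : a * b = mulMap a b := rfl
theorem one_def : (1 : WeylAlg τ) = W τ 0 := rfl

theorem W_mul_W (x y : G) : W τ x * W τ y = τ.phase x y • W τ (x + y) := by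
  simp [mul_def, mulMap, lift_W]

theorem smul_mul' (c : ℂ) (a b : WeylAlg τ) : (c • a) * b = c • (a * b) := by simp [mul_def]
theorem mul_smul' (c : ℂ) (a b : WeylAlg τ) : a * (c • b) = c • (a * b) := by simp [mul_def]
theorem add_mul' (a b c : WeylAlg τ) : (a + b) * c = a * c + b * c := by simp [mul_def]
theorem mul_add' (a b c : WeylAlg τ) : a * (b + c) = a * b + a * c := by simp [mul_def]
theorem zero_mul' (a : WeylAlg τ) : 0 * a = 0 := by simp [mul_def]
theorem mul_zero' (a : WeylAlg τ) : a * 0 = 0 := by simp [mul_def]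

instance : Ring (WeylAlg τ) where
  __ := (inferInstance : AddCommGroup (WeylAlg τ))
  left_distrib := mul_add'
  right_distrib := add_mul'
  zero_mul := zero_mul'
  mul_zero := mul_zero'
  one_mul a := by
    induction a using induction with
    | h0 => exact mul_zero' _
    | hadd a b ha hb => rw [mul_add', ha, hb]
    | hW c x => rw [mul_smul', one_def, W_mul_W, τ.phase_zero_left, zero_add, one_smul]
  mul_one a := by
    induction a using induction with
    | h0 => exact zero_mul' _
    | hadd a b ha hb => rw [add_mul', ha, hb]
    | hW c x => rw [smul_mul', one_def, W_mul_W, τ.phase_zero_right, add_zero, one_smul]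
  mul_assoc a b c := by
    induction a using induction with
    | h0 => simp only [zero_mul']
    | hadd a b ha hb => simp only [add_mul', ha, hb]
    | hW r x =>
      induction b using induction with
      | h0 => simp only [zero_mul', mul_zero']
      | hadd a b ha hb => simp only [add_mul', mul_add', ha, hb]
      | hW s y =>
        induction c using induction with
        | h0 => simp only [mul_zero']
        | hadd a b ha hb => simp only [mul_add', ha, hb]
        | hW t z =>
          simp only [smul_mul', mul_smul', W_mul_W, smul_smul, τ.phase_add_left,
            τ.phase_add_right, add_assoc]
          congr 1
          ring

instance : Algebra ℂ (WeylAlg τ) := Algebra.ofModule smul_mul' mul_smul'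

/-- The antilinear involution with `W(x)⋆ = W(-x)`. -/
def starMap : WeylAlg τ →+ WeylAlg τ :=
  (Finsupp.mapRange.addMonoidHom (starRingEnd ℂ).toAddMonoidHom).comp
    (Finsupp.mapDomain.addMonoidHom (M := ℂ) (fun x : G => -x))

theorem starMap_smul_W (c : ℂ) (x : G) : starMap (c • W τ x) = star c • W τ (-x) := by
  change Finsupp.mapRange (starRingEnd ℂ) (map_zero _)
    (Finsupp.mapDomain (fun x : G => -x) (c • (Finsupp.single x (1 : ℂ) : G →₀ ℂ))) =
    star c • (Finsupp.single (-x) (1 : ℂ) : G →₀ ℂ)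
  simp [Finsupp.mapDomain_single]

instance : Star (WeylAlg τ) := ⟨starMap⟩

theorem star_def (a : WeylAlg τ) : star a = starMap a := rfl

theorem star_smul_W (c : ℂ) (x : G) : star (c • W τ x) = star c • W τ (-x) :=
  starMap_smul_W c x

theorem star_W (x : G) : star (W τ x) = W τ (-x) := by
  simpa using star_smul_W (τ := τ) 1 x

instance : StarRing (WeylAlg τ) where
  star_add a b := by simp [star_def]
  star_involutive a := by
    induction a using induction with
    | h0 => simp [star_def]
    | hadd a b ha hb => simp only [star_def, map_add] at *; rw [ha, hb]
    | hW c x => simp [star_smul_W]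
  star_mul a b := by
    induction a using induction with
    | h0 => simp [star_def]
    | hadd a b ha hb => simp only [star_def, map_add, add_mul, mul_add] at *; rw [ha, hb]
    | hW c x =>
      induction b using induction with
      | h0 => simp [star_def]
      | hadd a b ha hb => simp only [star_def, map_add, add_mul, mul_add] at *; rw [ha, hb]
      | hW d y =>
        simp only [smul_mul', mul_smul', W_mul_W, smul_smul, star_smul_W, τ.phase_star,
          neg_add, star_mul', add_comm (-x)]
        congr 1
        ring

instance : StarModule ℂ (WeylAlg τ) where
  star_smul c a := by
    induction a using induction with
    | h0 => rw [smul_zero, star_zero, smul_zero]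
    | hadd a b ha hb => rw [smul_add, star_add, star_add, smul_add, ha, hb]
    | hW d x => simp [smul_smul, star_smul_W]

end WeylAlg

section States

variable {A : Type*} [Ring A] [StarRing A] [Algebra ℂ A]

/-- A state on a unital ⋆-algebra: a linear functional which is positive, `ω(a⋆ a) ≥ 0`, and
normalized, `ω(1) = 1`. -/
structure IsState (ω : A →ₗ[ℂ] ℂ) : Prop where
  re_nonneg : ∀ a, 0 ≤ (ω (star a * a)).re
  im_eq_zero : ∀ a, (ω (star a * a)).im = 0
  map_one : ω 1 = 1

/-- The seminorm `a ↦ √(ω(a⋆ a))`. -/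
def stateNorm (ω : A →ₗ[ℂ] ℂ) (a : A) : ℝ := Real.sqrt (ω (star a * a)).re

theorem stateNorm_nonneg (ω : A →ₗ[ℂ] ℂ) (a : A) : 0 ≤ stateNorm ω a :=
  Real.sqrt_nonneg _

theorem IsState.sq_stateNorm {ω : A →ₗ[ℂ] ℂ} (hω : IsState ω) (a : A) :
    ((stateNorm ω a ^ 2 : ℝ) : ℂ) = ω (star a * a) := by
  rw [stateNorm, Real.sq_sqrt (hω.re_nonneg a)]
  exact Complex.ext rfl (by simp [hω.im_eq_zero a])

namespace IsState

variable [StarModule ℂ A] {ω : A →ₗ[ℂ] ℂ}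

theorem conj_symm (hω : IsState ω) (a b : A) :
    (starRingEnd ℂ) (ω (star b * a)) = ω (star a * b) := by
  have h1 := hω.im_eq_zero (a + b)
  have h2 := hω.im_eq_zero (a + Complex.I • b)
  have ha := hω.im_eq_zero a
  have hb := hω.im_eq_zero b
  simp only [star_add, star_smul, add_mul, mul_add, smul_mul_assoc, mul_smul_comm, map_add,
    map_smul, Complex.add_im, smul_eq_mul, Complex.mul_im, Complex.mul_re, ha, hb,
    RCLike.star_def, Complex.conj_I, Complex.neg_re, Complex.neg_im, Complex.I_re,
    Complex.I_im] at h1 h2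
  apply Complex.ext
  · simp only [Complex.conj_re]; linarith
  · simp only [Complex.conj_im]; linarith

/-- The semi-inner product `(a, b) ↦ ω(a⋆ b)`. -/
abbrev core (hω : IsState ω) : PreInnerProductSpace.Core ℂ A where
  inner a b := ω (star a * b)
  conj_inner_symm a b := hω.conj_symm a b
  re_inner_nonneg a := hω.re_nonneg a
  add_left a b c := by rw [star_add, add_mul, map_add]
  smul_left a b r := by
    rw [star_smul, smul_mul_assoc, map_smul]; rfl

end IsState

namespace IsState

variable [StarModule ℂ A] {ω : A →ₗ[ℂ] ℂ}

theorem norm_apply_le (hω : IsState ω) (a b : A) :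
    ‖ω (star a * b)‖ ≤ stateNorm ω a * stateNorm ω b := by
  let := hω.core
  exact InnerProductSpace.Core.norm_inner_le_norm (𝕜 := ℂ) a b

theorem stateNorm_add_le (hω : IsState ω) (a b : A) :
    stateNorm ω (a + b) ≤ stateNorm ω a + stateNorm ω b := by
  let c := hω.core
  let : SeminormedAddCommGroup A := InnerProductSpace.Core.toSeminormedAddCommGroup (c := c)
  exact norm_add_le a b

theorem stateNorm_smul (ω : A →ₗ[ℂ] ℂ) (c : ℂ) (a : A) :
    stateNorm ω (c • a) = ‖c‖ * stateNorm ω a := by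
  have : ω (star (c • a) * (c • a)) = ((‖c‖ ^ 2 : ℝ) : ℂ) * ω (star a * a) := by
    rw [star_smul, smul_mul_assoc, mul_smul_comm, smul_smul, map_smul, smul_eq_mul,
      RCLike.star_def, Complex.conj_mul', Complex.ofReal_pow]
  rw [stateNorm, this, Complex.re_ofReal_mul, Real.sqrt_mul (sq_nonneg _),
    Real.sqrt_sq (norm_nonneg _), stateNorm]

end IsState

end States

namespace WeylAlg

variable {G : Type*} [AddCommGroup G] {τ : PresymplecticForm G}

theorem stateNorm_W {ω : WeylAlg τ →ₗ[ℂ] ℂ} (hω : IsState ω) (x : G) :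
    stateNorm ω (W τ x) = 1 := by
  rw [stateNorm, star_W, W_mul_W, τ.phase_neg_self, one_smul, neg_add_cancel, ← one_def,
    hω.map_one, Complex.one_re, Real.sqrt_one]

theorem exists_bound (a : WeylAlg τ) :
    ∃ C : ℝ, ∀ ω : WeylAlg τ →ₗ[ℂ] ℂ, IsState ω → stateNorm ω a ≤ C := by
  induction a using induction with
  | h0 => exact ⟨0, fun ω _ => by simp [stateNorm]⟩
  | hadd a b ha hb =>
    obtain ⟨C, hC⟩ := ha
    obtain ⟨D, hD⟩ := hb
    exact ⟨C + D, fun ω hω => (hω.stateNorm_add_le a b).trans (add_le_add (hC ω hω) (hD ω hω))⟩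
  | hW c x => exact ⟨‖c‖, fun ω hω => by rw [IsState.stateNorm_smul, stateNorm_W hω, mul_one]⟩

/-- The minimal regular norm `‖a‖ = sup_ω √(ω(a⋆ a))`, the supremum over all states. A state on the
linear span of the Weyl generators extends uniquely to a continuous state on its completion in the
`ℓ¹`-norm `∑ |α_i|`, and `‖a‖` is bounded by this norm, so that completing in the `ℓ¹`-norm first
and then in the minimal regular norm gives the same algebra. -/
instance : Norm (WeylAlg τ) :=
  ⟨fun a => ⨆ ω : {ω : WeylAlg τ →ₗ[ℂ] ℂ // IsState ω}, stateNorm ω.1 a⟩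

theorem norm_def (a : WeylAlg τ) :
    ‖a‖ = ⨆ ω : {ω : WeylAlg τ →ₗ[ℂ] ℂ // IsState ω}, stateNorm ω.1 a := rfl

theorem bddAbove_stateNorm (a : WeylAlg τ) :
    BddAbove (Set.range fun ω : {ω : WeylAlg τ →ₗ[ℂ] ℂ // IsState ω} => stateNorm ω.1 a) := by
  obtain ⟨C, hC⟩ := exists_bound a
  exact ⟨C, by rintro _ ⟨ω, rfl⟩; exact hC ω.1 ω.2⟩

theorem stateNorm_le {ω : WeylAlg τ →ₗ[ℂ] ℂ} (hω : IsState ω) (a : WeylAlg τ) :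
    stateNorm ω a ≤ ‖a‖ :=
  le_ciSup (bddAbove_stateNorm a) ⟨ω, hω⟩

theorem norm_nonneg' (a : WeylAlg τ) : 0 ≤ ‖a‖ :=
  Real.iSup_nonneg fun ω => stateNorm_nonneg ω.1 a

theorem norm_le' {a : WeylAlg τ} {C : ℝ} (hC : 0 ≤ C)
    (h : ∀ ω : WeylAlg τ →ₗ[ℂ] ℂ, IsState ω → stateNorm ω a ≤ C) : ‖a‖ ≤ C :=
  Real.iSup_le (fun ω => h ω.1 ω.2) hC

theorem norm_add_le' (a b : WeylAlg τ) : ‖a + b‖ ≤ ‖a‖ + ‖b‖ :=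
  norm_le' (add_nonneg (norm_nonneg' a) (norm_nonneg' b)) fun _ hω =>
    (hω.stateNorm_add_le a b).trans (add_le_add (stateNorm_le hω a) (stateNorm_le hω b))

theorem norm_smul_le' (c : ℂ) (a : WeylAlg τ) : ‖c • a‖ ≤ ‖c‖ * ‖a‖ :=
  norm_le' (mul_nonneg (norm_nonneg c) (norm_nonneg' a)) fun ω hω => by
    rw [IsState.stateNorm_smul]
    exact mul_le_mul_of_nonneg_left (stateNorm_le hω a) (norm_nonneg c)

/-- The state `a ↦ ω (b* a b) / ω (b* b)`. -/
theorem isState_conj {ω : WeylAlg τ →ₗ[ℂ] ℂ} (hω : IsState ω) {b : WeylAlg τ}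
    (hb : stateNorm ω b ≠ 0) :
    IsState ((((stateNorm ω b ^ 2)⁻¹ : ℝ) : ℂ) •
      ω ∘ₗ LinearMap.mulLeft ℂ (star b) ∘ₗ LinearMap.mulRight ℂ b) where
  re_nonneg a := by
    have h := hω.re_nonneg (a * b)
    have e : star b * (star a * a * b) = star (a * b) * (a * b) := by simp [mul_assoc]
    simp only [LinearMap.smul_apply, LinearMap.comp_apply, LinearMap.mulLeft_apply,
      LinearMap.mulRight_apply, smul_eq_mul, Complex.re_ofReal_mul, e]
    positivity
  im_eq_zero a := by
    have h := hω.im_eq_zero (a * b)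
    have e : star b * (star a * a * b) = star (a * b) * (a * b) := by simp [mul_assoc]
    simp only [LinearMap.smul_apply, LinearMap.comp_apply, LinearMap.mulLeft_apply,
      LinearMap.mulRight_apply, smul_eq_mul, Complex.im_ofReal_mul, e, h, mul_zero]
  map_one := by
    simp only [LinearMap.smul_apply, LinearMap.comp_apply, LinearMap.mulLeft_apply,
      LinearMap.mulRight_apply, smul_eq_mul, one_mul, ← hω.sq_stateNorm b]
    rw [← Complex.ofReal_mul, inv_mul_cancel₀ (pow_ne_zero 2 hb), Complex.ofReal_one]

theorem stateNorm_mul_le {ω : WeylAlg τ →ₗ[ℂ] ℂ} (hω : IsState ω) (a b : WeylAlg τ) :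
    stateNorm ω (a * b) ≤ ‖a‖ * stateNorm ω b := by
  by_cases hb : stateNorm ω b = 0
  · have h := hω.norm_apply_le b (star a * (a * b))
    have e : star b * (star a * (a * b)) = star (a * b) * (a * b) := by simp [mul_assoc]
    rw [hb, zero_mul, e] at h
    have h0 : ω (star (a * b) * (a * b)) = 0 := norm_le_zero_iff.mp h
    rw [stateNorm, h0, hb, Complex.zero_re, Real.sqrt_zero, mul_zero]
  · have h := stateNorm_le (isState_conj hω hb) a
    have e : star b * (star a * a * b) = star (a * b) * (a * b) := by simp [mul_assoc]
    have e2 : stateNorm ((((stateNorm ω b ^ 2)⁻¹ : ℝ) : ℂ) •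
        ω ∘ₗ LinearMap.mulLeft ℂ (star b) ∘ₗ LinearMap.mulRight ℂ b) a =
        (stateNorm ω b)⁻¹ * stateNorm ω (a * b) := by
      rw [stateNorm]
      simp only [LinearMap.smul_apply, LinearMap.comp_apply, LinearMap.mulLeft_apply,
        LinearMap.mulRight_apply, smul_eq_mul, Complex.re_ofReal_mul, e]
      rw [Real.sqrt_mul (by positivity), Real.sqrt_inv, Real.sqrt_sq (stateNorm_nonneg ω b)]
      rfl
    have hpos : 0 < stateNorm ω b := lt_of_le_of_ne (stateNorm_nonneg ω b) (Ne.symm hb)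
    rw [e2, inv_mul_le_iff₀ hpos] at h
    linarith

theorem norm_mul_le' (a b : WeylAlg τ) : ‖a * b‖ ≤ ‖a‖ * ‖b‖ :=
  norm_le' (mul_nonneg (norm_nonneg' a) (norm_nonneg' b)) fun _ hω =>
    (stateNorm_mul_le hω a b).trans
      (mul_le_mul_of_nonneg_left (stateNorm_le hω b) (norm_nonneg' a))

theorem norm_mul_self_le' (a : WeylAlg τ) : ‖a‖ * ‖a‖ ≤ ‖star a * a‖ := by
  have key : ‖a‖ ≤ Real.sqrt ‖star a * a‖ := by
    refine norm_le' (Real.sqrt_nonneg _) fun ω hω => Real.sqrt_le_sqrt ?_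
    have h := hω.norm_apply_le 1 (star a * a)
    rw [one_def, stateNorm_W hω, star_W, neg_zero, ← one_def, one_mul, one_mul] at h
    exact (Complex.re_le_norm _).trans (h.trans (stateNorm_le hω _))
  calc ‖a‖ * ‖a‖ ≤ Real.sqrt ‖star a * a‖ * Real.sqrt ‖star a * a‖ :=
        mul_self_le_mul_self (norm_nonneg' a) key
    _ = ‖star a * a‖ := Real.mul_self_sqrt (norm_nonneg' _)

instance : SeminormedAddCommGroup (WeylAlg τ) :=
  AddGroupSeminorm.toSeminormedAddCommGroup
    { toFun := norm
      map_zero' := le_antisymm (by simpa using norm_smul_le' 0 (0 : WeylAlg τ)) (norm_nonneg' 0)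
      add_le' := norm_add_le'
      neg' := fun a => le_antisymm (by simpa using norm_smul_le' (-1) a)
        (by simpa using norm_smul_le' (-1) (-a)) }

instance : SeminormedRing (WeylAlg τ) where
  __ := (inferInstance : SeminormedAddCommGroup (WeylAlg τ))
  __ := (inferInstance : Ring (WeylAlg τ))
  norm_mul_le := norm_mul_le'

instance : NormedAlgebra ℂ (WeylAlg τ) where
  norm_smul_le := norm_smul_le'

theorem norm_star' (a : WeylAlg τ) : ‖star a‖ = ‖a‖ := by
  have h : ∀ b : WeylAlg τ, ‖b‖ ≤ ‖star b‖ := fun b => by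
    by_cases hb : ‖b‖ = 0
    · rw [hb]; exact norm_nonneg _
    · have hpos : 0 < ‖b‖ := lt_of_le_of_ne (norm_nonneg b) (Ne.symm hb)
      exact le_of_mul_le_mul_right ((norm_mul_self_le' b).trans (norm_mul_le _ _)) hpos
  exact le_antisymm (by simpa using h (star a)) (h a)

instance : NormedStarGroup (WeylAlg τ) := ⟨fun a => (norm_star' a).le⟩

end WeylAlg

/-- The Weyl C⋆-algebra `CCR(G, τ)`: the completion in the minimal regular norm. -/
def CCR {G : Type*} [AddCommGroup G] (τ : PresymplecticForm G) : Type _ :=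
  UniformSpace.Completion (WeylAlg τ)

namespace CCR

open UniformSpace

variable {G : Type*} [AddCommGroup G] {τ : PresymplecticForm G}

instance : NormedRing (CCR τ) := inferInstanceAs (NormedRing (Completion (WeylAlg τ)))

instance : CompleteSpace (CCR τ) := inferInstanceAs (CompleteSpace (Completion (WeylAlg τ)))

instance : Algebra ℂ (CCR τ) := inferInstanceAs (Algebra ℂ (Completion (WeylAlg τ)))

/-- The canonical map into the completion. -/
def ofWeyl (a : WeylAlg τ) : CCR τ := (a : Completion (WeylAlg τ))

theorem isUniformInducing_ofWeyl : IsUniformInducing (ofWeyl : WeylAlg τ → CCR τ) :=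
  Completion.isUniformInducing_coe (WeylAlg τ)

theorem continuous_ofWeyl : Continuous (ofWeyl : WeylAlg τ → CCR τ) :=
  isUniformInducing_ofWeyl.uniformContinuous.continuous

theorem denseRange_ofWeyl : DenseRange (ofWeyl : WeylAlg τ → CCR τ) :=
  Completion.denseRange_coe

theorem norm_ofWeyl (a : WeylAlg τ) : ‖ofWeyl a‖ = ‖a‖ := Completion.norm_coe a
theorem ofWeyl_add (a b : WeylAlg τ) : ofWeyl (a + b) = ofWeyl a + ofWeyl b :=
  Completion.coe_add a b
theorem ofWeyl_mul (a b : WeylAlg τ) : ofWeyl (a * b) = ofWeyl a * ofWeyl b :=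
  Completion.coe_mul a b
theorem ofWeyl_one : ofWeyl (1 : WeylAlg τ) = 1 := rfl
theorem ofWeyl_zero : ofWeyl (0 : WeylAlg τ) = 0 := rfl
theorem ofWeyl_smul (c : ℂ) (a : WeylAlg τ) : ofWeyl (c • a) = c • ofWeyl a :=
  Completion.coe_smul c a

theorem induction {p : CCR τ → Prop} (hc : IsClosed {a | p a}) (h : ∀ a, p (ofWeyl a))
    (a : CCR τ) : p a := Completion.induction_on a hc h

theorem induction₂ {p : CCR τ → CCR τ → Prop} (hc : IsClosed {x : CCR τ × CCR τ | p x.1 x.2})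
    (h : ∀ a b, p (ofWeyl a) (ofWeyl b)) (a b : CCR τ) : p a b :=
  Completion.induction_on₂ a b hc h

instance : NormedAlgebra ℂ (CCR τ) where
  norm_smul_le c a := by
    refine induction (p := fun a => ‖c • a‖ ≤ ‖c‖ * ‖a‖) ?_ (fun a => ?_) a
    · have : Continuous fun a : CCR τ => c • a :=
        (uniformContinuous_const_smul (M := ℂ) (X := Completion (WeylAlg τ)) c).continuous
      exact isClosed_le this.norm (continuous_const.mul continuous_norm)
    · rw [← ofWeyl_smul, norm_ofWeyl, norm_ofWeyl]
      exact norm_smul_le c a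

instance : Star (CCR τ) := ⟨Completion.map (star : WeylAlg τ → WeylAlg τ)⟩

theorem star_ofWeyl (a : WeylAlg τ) : star (ofWeyl a) = ofWeyl (star a) :=
  Completion.map_coe (star_isometry (E := WeylAlg τ)).uniformContinuous a

theorem continuous_star' : Continuous (star : CCR τ → CCR τ) :=
  Completion.continuous_map

instance : StarRing (CCR τ) where
  star_involutive := by
    refine induction (isClosed_eq (continuous_star'.comp continuous_star') continuous_id) ?_
    intro a
    rw [star_ofWeyl, star_ofWeyl, star_star]
  star_add := by
    refine induction₂ (isClosed_eq ?_ ?_) ?_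
    · exact continuous_star'.comp continuous_add
    · exact (continuous_star'.comp continuous_fst).add (continuous_star'.comp continuous_snd)
    · intro a b
      rw [← ofWeyl_add, star_ofWeyl, star_ofWeyl, star_ofWeyl, star_add, ofWeyl_add]
  star_mul := by
    refine induction₂ (isClosed_eq ?_ ?_) ?_
    · exact continuous_star'.comp continuous_mul
    · exact (continuous_star'.comp continuous_snd).mul (continuous_star'.comp continuous_fst)
    · intro a b
      rw [← ofWeyl_mul, star_ofWeyl, star_ofWeyl, star_ofWeyl, star_mul, ofWeyl_mul]

instance : StarModule ℂ (CCR τ) where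
  star_smul c := by
    refine induction (isClosed_eq ?_ ?_) ?_
    · exact continuous_star'.comp (continuous_const_smul c)
    · exact continuous_star'.const_smul (star c)
    · intro a
      rw [← ofWeyl_smul, star_ofWeyl, star_ofWeyl, star_smul, ofWeyl_smul]

instance : CStarRing (CCR τ) where
  norm_mul_self_le := by
    refine induction (isClosed_le ?_ ?_) ?_
    · exact continuous_norm.mul continuous_norm
    · exact (continuous_star'.mul continuous_id).norm
    · intro a
      rw [star_ofWeyl, ← ofWeyl_mul, norm_ofWeyl, norm_ofWeyl]
      exact WeylAlg.norm_mul_self_le' a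

instance : CStarAlgebra (CCR τ) where

/-- The Weyl element `W(x)` of `CCR(G, τ)`. -/
def W (τ : PresymplecticForm G) (x : G) : CCR τ := ofWeyl (WeylAlg.W τ x)

end CCR

namespace WeylAlg

variable {G G' : Type*} [AddCommGroup G] [AddCommGroup G'] {τ : PresymplecticForm G}
  {τ' : PresymplecticForm G'}

/-- The ⋆-homomorphism `W(x) ↦ W(ψ(x))` induced by a homomorphism of pre-symplectic groups. -/
def map (ψ : G →+ G') (hψ : ∀ x y, τ'.toHom (ψ x) (ψ y) = τ.toHom x y) :
    WeylAlg τ →⋆ₐ[ℂ] WeylAlg τ' where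
  __ := AlgHom.ofLinearMap (lift fun x => W τ' (ψ x))
    (by rw [one_def, lift_W, map_zero, one_def])
    (fun a b => by
      induction a using induction with
      | h0 => simp
      | hadd a b ha hb => simp only [add_mul, map_add, ha, hb]
      | hW c x =>
        induction b using induction with
        | h0 => simp
        | hadd a b ha hb => simp only [mul_add, map_add, ha, hb]
        | hW d y =>
          simp only [smul_mul', mul_smul', W_mul_W, map_smul, lift_W, map_add,
            PresymplecticForm.phase, hψ])
  map_star' a := by
    change lift (fun x => W τ' (ψ x)) (star a) = star (lift (fun x => W τ' (ψ x)) a)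
    induction a using induction with
    | h0 => simp
    | hadd a b ha hb => simp only [star_add, map_add, ha, hb]
    | hW c x => simp only [star_smul_W, map_smul, lift_W, map_neg]

variable (ψ : G →+ G') (hψ : ∀ x y, τ'.toHom (ψ x) (ψ y) = τ.toHom x y)

theorem map_W (x : G) : map ψ hψ (W τ x) = W τ' (ψ x) :=
  lift_W (τ := τ) (fun x => W τ' (ψ x)) x

theorem norm_map_le (a : WeylAlg τ) : ‖map ψ hψ a‖ ≤ ‖a‖ := by
  refine norm_le' (norm_nonneg a) fun ω hω => ?_
  have hs : IsState (ω ∘ₗ (map ψ hψ).toAlgHom.toLinearMap) :=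
    { re_nonneg := fun b => by
        have := hω.re_nonneg (map ψ hψ b)
        rwa [← map_star, ← map_mul] at this
      im_eq_zero := fun b => by
        have := hω.im_eq_zero (map ψ hψ b)
        rwa [← map_star, ← map_mul] at this
      map_one := by
        have := hω.map_one
        rwa [← map_one (map ψ hψ)] at this }
  have h := stateNorm_le hs a
  have e : stateNorm (ω ∘ₗ (map ψ hψ).toAlgHom.toLinearMap) a = stateNorm ω (map ψ hψ a) := by
    rw [stateNorm, stateNorm, ← map_star, ← map_mul]
    rfl
  rwa [e] at h

theorem uniformContinuous_map : UniformContinuous (map ψ hψ) :=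
  (AddMonoidHomClass.lipschitz_of_bound (map ψ hψ) 1
    (fun a => by simpa using norm_map_le ψ hψ a)).uniformContinuous

end WeylAlg

namespace CCR

open UniformSpace

variable {G G' : Type*} [AddCommGroup G] [AddCommGroup G'] {τ : PresymplecticForm G}
  {τ' : PresymplecticForm G'}

/-- The map underlying `CCR.map`. -/
def mapFun (ψ : G →+ G') (hψ : ∀ x y, τ'.toHom (ψ x) (ψ y) = τ.toHom x y) :
    CCR τ → CCR τ' := Completion.map (WeylAlg.map ψ hψ)

theorem mapFun_ofWeyl (ψ : G →+ G') (hψ : ∀ x y, τ'.toHom (ψ x) (ψ y) = τ.toHom x y)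
    (a : WeylAlg τ) : mapFun ψ hψ (ofWeyl a) = ofWeyl (WeylAlg.map ψ hψ a) :=
  Completion.map_coe (WeylAlg.uniformContinuous_map ψ hψ) a

theorem continuous_mapFun (ψ : G →+ G') (hψ : ∀ x y, τ'.toHom (ψ x) (ψ y) = τ.toHom x y) :
    Continuous (mapFun ψ hψ) := Completion.continuous_map

/-- The functor `CCR` on a homomorphism `ψ` of pre-symplectic groups: `W(x) ↦ W(ψ(x))`. -/
def map (ψ : G →+ G') (hψ : ∀ x y, τ'.toHom (ψ x) (ψ y) = τ.toHom x y) :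
    CCR τ →⋆ₐ[ℂ] CCR τ' where
  toFun := mapFun ψ hψ
  map_one' := (mapFun_ofWeyl ψ hψ 1).trans (congrArg ofWeyl (map_one _))
  map_zero' := (mapFun_ofWeyl ψ hψ 0).trans (congrArg ofWeyl (map_zero _))
  map_mul' := by
    have hc := continuous_mapFun ψ hψ
    refine induction₂ (isClosed_eq (hc.comp continuous_mul)
      ((hc.comp continuous_fst).mul (hc.comp continuous_snd))) fun a b => ?_
    simp only [← ofWeyl_mul, mapFun_ofWeyl, map_mul]
  map_add' := by
    have hc := continuous_mapFun ψ hψ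
    refine induction₂ (isClosed_eq (hc.comp continuous_add)
      ((hc.comp continuous_fst).add (hc.comp continuous_snd))) fun a b => ?_
    simp only [← ofWeyl_add, mapFun_ofWeyl, map_add]
  commutes' c := (mapFun_ofWeyl ψ hψ (algebraMap ℂ _ c)).trans
    (congrArg ofWeyl (AlgHomClass.commutes _ c))
  map_star' := by
    have hc := continuous_mapFun ψ hψ
    refine induction (isClosed_eq (hc.comp continuous_star') (continuous_star'.comp hc))
      fun a => ?_
    simp only [star_ofWeyl, mapFun_ofWeyl, map_star]

theorem map_ofWeyl (ψ : G →+ G') (hψ : ∀ x y, τ'.toHom (ψ x) (ψ y) = τ.toHom x y)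
    (a : WeylAlg τ) : map ψ hψ (ofWeyl a) = ofWeyl (WeylAlg.map ψ hψ a) :=
  mapFun_ofWeyl ψ hψ a

theorem continuous_map (ψ : G →+ G') (hψ : ∀ x y, τ'.toHom (ψ x) (ψ y) = τ.toHom x y) :
    Continuous (map ψ hψ) := continuous_mapFun ψ hψ

theorem map_W (ψ : G →+ G') (hψ : ∀ x y, τ'.toHom (ψ x) (ψ y) = τ.toHom x y) (x : G) :
    map ψ hψ (W τ x) = W τ' (ψ x) := by
  rw [W, map_ofWeyl, WeylAlg.map_W, W]

theorem map_map_of_leftInverse (ψ : G →+ G')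
    (hψ : ∀ x y, τ'.toHom (ψ x) (ψ y) = τ.toHom x y) (χ : G' →+ G)
    (hχ : ∀ x y, τ.toHom (χ x) (χ y) = τ'.toHom x y) (h : ∀ x, χ (ψ x) = x) (a : CCR τ) :
    map χ hχ (map ψ hψ a) = a := by
  refine induction (isClosed_eq ((continuous_map χ hχ).comp (continuous_map ψ hψ))
    continuous_id) (fun a => ?_) a
  change map χ hχ (map ψ hψ (ofWeyl a)) = ofWeyl a
  rw [map_ofWeyl, map_ofWeyl]
  congr 1
  induction a using WeylAlg.induction with
  | h0 => simp
  | hadd a b ha hb => rw [map_add, map_add, ha, hb]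
  | hW c x => rw [map_smul, map_smul, WeylAlg.map_W, WeylAlg.map_W, h]

/-- The functor `CCR` on an isomorphism `ψ` of pre-symplectic groups. -/
def equiv (ψ : G ≃+ G') (hψ : ∀ x y, τ'.toHom (ψ x) (ψ y) = τ.toHom x y) :
    CCR τ ≃⋆ₐ[ℂ] CCR τ' :=
  have hχ : ∀ x y, τ.toHom (ψ.symm x) (ψ.symm y) = τ'.toHom x y := fun x y => by
    rw [← hψ, ψ.apply_symm_apply, ψ.apply_symm_apply]
  { map (ψ : G →+ G') hψ with
    invFun := map (ψ.symm : G' →+ G) hχ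
    left_inv := map_map_of_leftInverse _ _ _ _ ψ.symm_apply_apply
    right_inv := map_map_of_leftInverse _ _ _ _ ψ.apply_symm_apply
    map_smul' := fun c a => map_smul (map (ψ : G →+ G') hψ) c a }

theorem equiv_W (ψ : G ≃+ G') (hψ : ∀ x y, τ'.toHom (ψ x) (ψ y) = τ.toHom x y) (x : G) :
    equiv ψ hψ (W τ x) = W τ' (ψ x) := map_W (ψ : G →+ G') hψ x

end CCR

namespace Cylinder

open MeasureTheory

/-- The spacetime `M = ℝ × S¹`, `S¹ = ℝ/ℤ`, with coordinates `(t, θ)` and metric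
`-dt ⊗ dt + dθ ⊗ dθ`. -/
abbrev Spacetime : Type := ℝ × UnitAddCircle

/-- Smoothness of a function on `ℝ × S¹`, tested on the covering `ℝ × ℝ`. -/
def IsSmooth (f : Spacetime → ℝ) : Prop :=
  ContDiff ℝ ((⊤ : ℕ∞) : WithTop ℕ∞) fun p : ℝ × ℝ => f (p.1, (p.2 : UnitAddCircle))

/-- The derivative `∂f/∂t`. -/
def partialT (f : Spacetime → ℝ) (p : Spacetime) : ℝ := deriv (fun s : ℝ => f (s, p.2)) p.1

/-- The derivative `∂f/∂θ`. -/
def partialTheta (f : Spacetime → ℝ) (p : Spacetime) : ℝ :=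
  deriv (fun y : ℝ => f (p.1, p.2 + (y : UnitAddCircle))) 0

/-- A one-form `ω_t dt + ω_θ dθ` on `M`, given by the pair `(ω_t, ω_θ)` of its components. -/
abbrev OneForm : Type := Spacetime → ℝ × ℝ

/-- The exterior derivative of a function. -/
def extD (f : Spacetime → ℝ) : OneForm := fun p => (partialT f p, partialTheta f p)

/-- The Hodge operator on one-forms: `*dt = -dθ` and `*dθ = -dt`. -/
def hodge : OneForm →ₗ[ℝ] OneForm where
  toFun ω p := (-(ω p).2, -(ω p).1)
  map_add' ω η := by ext p <;> simp [add_comm]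
  map_smul' c ω := by ext p <;> simp

theorem hodge_apply (ω : OneForm) (p : Spacetime) : hodge ω p = (-(ω p).2, -(ω p).1) := rfl

theorem hodge_hodge (ω : OneForm) : hodge (hodge ω) = ω := by
  ext p <;> simp [hodge_apply]

/-- The smooth functions `f`, `g` are potentials of the one-form `ω`: `ω = df = *dg`. -/
structure IsPotentialPair (f g : Spacetime → ℝ) (ω : OneForm) : Prop where
  smooth_left : IsSmooth f
  smooth_right : IsSmooth g
  extD_left : extD f = ω
  hodge_extD_right : hodge (extD g) = ω

namespace IsSmooth

variable {f g : Spacetime → ℝ}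

theorem add (hf : IsSmooth f) (hg : IsSmooth g) : IsSmooth (f + g) := ContDiff.add hf hg

theorem sub (hf : IsSmooth f) (hg : IsSmooth g) : IsSmooth (f - g) := ContDiff.sub hf hg

theorem mul (hf : IsSmooth f) (hg : IsSmooth g) : IsSmooth (f * g) := ContDiff.mul hf hg

theorem const_smul (hf : IsSmooth f) (c : ℝ) : IsSmooth (c • f) := ContDiff.const_smul c hf

theorem zero : IsSmooth 0 := contDiff_const

theorem comp_add (hf : IsSmooth f) (v : Spacetime) : IsSmooth fun p => f (p + v) := by
  obtain ⟨s, φ⟩ := v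
  obtain ⟨y, rfl⟩ := QuotientAddGroup.mk_surjective φ
  have h : ContDiff ℝ ((⊤ : ℕ∞) : WithTop ℕ∞) fun p : ℝ × ℝ => (p.1 + s, p.2 + y) := by fun_prop
  exact ContDiff.comp (g := fun p : ℝ × ℝ => f (p.1, (p.2 : UnitAddCircle))) hf h

theorem hasDerivAt_t (hf : IsSmooth f) (t : ℝ) (x : UnitAddCircle) :
    HasDerivAt (fun s : ℝ => f (s, x)) (partialT f (t, x)) t := by
  obtain ⟨y, rfl⟩ := QuotientAddGroup.mk_surjective x
  have h : Differentiable ℝ fun s : ℝ => f (s, (y : UnitAddCircle)) :=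
    (ContDiff.differentiable hf (by simp)).comp
      ((differentiable_id.prodMk (differentiable_const y)) :
        Differentiable ℝ fun s : ℝ => (s, y))
  exact (h t).hasDerivAt

theorem differentiable_theta (hf : IsSmooth f) (t : ℝ) (x : UnitAddCircle) :
    Differentiable ℝ fun y : ℝ => f (t, x + (y : UnitAddCircle)) := by
  obtain ⟨z, rfl⟩ := QuotientAddGroup.mk_surjective x
  exact (ContDiff.differentiable hf (by simp)).comp
    ((differentiable_const t).prodMk (differentiable_id.const_add z) :
      Differentiable ℝ fun y : ℝ => (t, z + y))

theorem hasDerivAt_theta (hf : IsSmooth f) (t : ℝ) (x : UnitAddCircle) (y : ℝ) :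
    HasDerivAt (fun y : ℝ => f (t, x + (y : UnitAddCircle)))
      (partialTheta f (t, x + (y : UnitAddCircle))) y := by
  have h := (hf.differentiable_theta t (x + (y : UnitAddCircle)) 0).hasDerivAt
  have h2 : HasDerivAt (fun u : ℝ => f (t, x + (y : UnitAddCircle) + ((u - y : ℝ) : UnitAddCircle)))
      (partialTheta f (t, x + (y : UnitAddCircle))) y := by
    have h' : HasDerivAt (fun u : ℝ => f (t, x + (y : UnitAddCircle) + (u : UnitAddCircle)))
      (partialTheta f (t, x + (y : UnitAddCircle))) (y - y) := by rw [sub_self]; exact h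
    exact h'.comp_sub_const y y
  refine h2.congr_of_eventuallyEq (Filter.Eventually.of_forall fun u => ?_)
  simp only [AddCircle.coe_sub, add_assoc, add_sub_cancel]

theorem hasDerivAt_theta_coe (hf : IsSmooth f) (t y : ℝ) :
    HasDerivAt (fun y : ℝ => f (t, (y : UnitAddCircle)))
      (partialTheta f (t, (y : UnitAddCircle))) y := by
  simpa using hf.hasDerivAt_theta t 0 y

theorem continuous_slice (hf : IsSmooth f) (t : ℝ) : Continuous fun x => f (t, x) := by
  refine continuous_coinduced_dom.2 ?_
  exact (ContDiff.continuous hf).comp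
    (continuous_const.prodMk continuous_id : Continuous fun y : ℝ => (t, y))

theorem continuous_partialTheta (hf : IsSmooth f) (t : ℝ) :
    Continuous fun x => partialTheta f (t, x) := by
  refine continuous_coinduced_dom.2 ?_
  have h : ContDiff ℝ ((⊤ : ℕ∞) : WithTop ℕ∞) fun y : ℝ => f (t, (y : UnitAddCircle)) :=
    ContDiff.comp (g := fun p : ℝ × ℝ => f (p.1, (p.2 : UnitAddCircle))) hf
      (contDiff_const.prodMk contDiff_id : ContDiff ℝ ((⊤ : ℕ∞) : WithTop ℕ∞) fun y : ℝ => (t, y))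
  have h2 := h.continuous_deriv (by simp)
  convert h2 using 1
  funext y
  exact (hf.hasDerivAt_theta_coe t y).deriv.symm

theorem extD_add (hf : IsSmooth f) (hg : IsSmooth g) : extD (f + g) = extD f + extD g := by
  funext ⟨t, x⟩
  have h1 := (hf.hasDerivAt_t t x).add (hg.hasDerivAt_t t x)
  have h2 := (hf.differentiable_theta t x 0).hasDerivAt.add
    (hg.differentiable_theta t x 0).hasDerivAt
  exact Prod.ext h1.deriv h2.deriv

theorem extD_sub (hf : IsSmooth f) (hg : IsSmooth g) : extD (f - g) = extD f - extD g := by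
  funext ⟨t, x⟩
  have h1 := (hf.hasDerivAt_t t x).sub (hg.hasDerivAt_t t x)
  have h2 := (hf.differentiable_theta t x 0).hasDerivAt.sub
    (hg.differentiable_theta t x 0).hasDerivAt
  exact Prod.ext h1.deriv h2.deriv

theorem extD_smul (hf : IsSmooth f) (c : ℝ) : extD (c • f) = c • extD f := by
  funext ⟨t, x⟩
  have h1 := (hf.hasDerivAt_t t x).const_smul c
  have h2 := (hf.differentiable_theta t x 0).hasDerivAt.const_smul c
  exact Prod.ext h1.deriv h2.deriv

theorem partialTheta_mul (hf : IsSmooth f) (hg : IsSmooth g) (p : Spacetime) :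
    partialTheta (f * g) p = partialTheta f p * g p + f p * partialTheta g p := by
  obtain ⟨t, x⟩ := p
  have h2 := (hf.differentiable_theta t x 0).hasDerivAt.mul
    (hg.differentiable_theta t x 0).hasDerivAt
  have h3 := h2.deriv
  simp only [AddCircle.coe_zero, add_zero] at h3
  exact h3

theorem hasDerivAt_line (hf : IsSmooth f) (c : ℝ) (x : UnitAddCircle) (u : ℝ) :
    HasDerivAt (fun u : ℝ => f (u, x + ((c * u : ℝ) : UnitAddCircle)))
      (partialT f (u, x + ((c * u : ℝ) : UnitAddCircle)) +
        c * partialTheta f (u, x + ((c * u : ℝ) : UnitAddCircle))) u := by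
  obtain ⟨y, rfl⟩ := QuotientAddGroup.mk_surjective x
  have hF := ((ContDiff.differentiable hf (by simp)) (u, y + c * u)).hasFDerivAt
  set L := fderiv ℝ (fun p : ℝ × ℝ => f (p.1, (p.2 : UnitAddCircle))) (u, y + c * u)
  have h1 : L (1, 0) = partialT f (u, ((y + c * u : ℝ) : UnitAddCircle)) := by
    have := hF.comp_hasDerivAt u ((hasDerivAt_id u).prodMk (hasDerivAt_const u (y + c * u)))
    exact this.unique (hf.hasDerivAt_t u ((y + c * u : ℝ) : UnitAddCircle))
  have h2 : L (0, 1) = partialTheta f (u, ((y + c * u : ℝ) : UnitAddCircle)) := by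
    have := hF.comp_hasDerivAt (y + c * u)
      ((hasDerivAt_const (y + c * u) u).prodMk (hasDerivAt_id (y + c * u)))
    exact this.unique (hf.hasDerivAt_theta_coe u _)
  have h3 := hF.comp_hasDerivAt u
    ((hasDerivAt_id u).prodMk (((hasDerivAt_id u).const_mul c).const_add y))
  have h4 : L (1, c * 1) = L (1, 0) + c * L (0, 1) := by
    rw [← smul_eq_mul c (L (0, 1)), ← map_smul, ← map_add]
    simp
  rw [h4, h1, h2] at h3
  exact h3

theorem eq_const (hf : IsSmooth f) (h : extD f = 0) (p : Spacetime) : f p = f 0 := by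
  obtain ⟨t, x⟩ := p
  have ht : ∀ s y, partialT f (s, y) = 0 := fun s y => congrArg Prod.fst (congrFun h (s, y))
  have hx : ∀ s y, partialTheta f (s, y) = 0 := fun s y => congrArg Prod.snd (congrFun h (s, y))
  have h1 : f (t, x) = f (0, x) :=
    is_const_of_deriv_eq_zero (fun s => (hf.hasDerivAt_t s x).differentiableAt)
      (fun s => (hf.hasDerivAt_t s x).deriv.trans (ht s x)) t 0
  obtain ⟨y, rfl⟩ := QuotientAddGroup.mk_surjective x
  have h2 : f (0, (y : UnitAddCircle)) = f (0, ((0 : ℝ) : UnitAddCircle)) :=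
    is_const_of_deriv_eq_zero (fun u => (hf.hasDerivAt_theta_coe 0 u).differentiableAt)
      (fun u => (hf.hasDerivAt_theta_coe 0 u).deriv.trans (hx 0 _)) y 0
  exact h1.trans h2

theorem integral_partialTheta (hf : IsSmooth f) (t : ℝ) :
    ∫ x : UnitAddCircle, partialTheta f (t, x) = 0 := by
  rw [← UnitAddCircle.intervalIntegral_preimage 0]
  rw [intervalIntegral.integral_eq_sub_of_hasDerivAt
    (fun y _ => hf.hasDerivAt_theta_coe t y)
    (((hf.continuous_partialTheta t).comp (AddCircle.continuous_mk' 1)).intervalIntegrable _ _)]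
  simp [AddCircle.coe_period]

end IsSmooth

theorem extD_comp_add (f : Spacetime → ℝ) (v : Spacetime) :
    extD (fun p => f (p + v)) = fun p => extD f (p + v) := by
  funext ⟨t, x⟩
  refine Prod.ext ?_ ?_
  · exact deriv_comp_add_const (fun s => f (s, x + v.2)) v.1 t
  · change deriv (fun y : ℝ => f (t + v.1, x + (y : UnitAddCircle) + v.2)) 0 =
      deriv (fun y : ℝ => f (t + v.1, x + v.2 + (y : UnitAddCircle))) 0
    simp only [add_right_comm x]

/-- The integral `∫_Σ (f' dg + f dg')` over the Cauchy surface `Σ = {0} × S¹`. -/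
def pairing (f f' g g' : Spacetime → ℝ) : ℝ :=
  ∫ x : UnitAddCircle, (f' (0, x) * partialTheta g (0, x) + f (0, x) * partialTheta g' (0, x))

theorem integrable_of_continuous {u : UnitAddCircle → ℝ} (hu : Continuous u) :
    Integrable u volume := hu.integrable_of_hasCompactSupport (HasCompactSupport.of_compactSpace u)

theorem pairing_eq {f f' g g' : Spacetime → ℝ} (hf : IsSmooth f) (hf' : IsSmooth f')
    (hg : IsSmooth g) (hg' : IsSmooth g') :
    pairing f f' g g' = (∫ x : UnitAddCircle, f' (0, x) * partialTheta g (0, x)) +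
      ∫ x : UnitAddCircle, f (0, x) * partialTheta g' (0, x) :=
  integral_add
    (integrable_of_continuous ((hf'.continuous_slice 0).mul (hg.continuous_partialTheta 0)))
    (integrable_of_continuous ((hf.continuous_slice 0).mul (hg'.continuous_partialTheta 0)))

theorem integral_congr_of_extD {f f₁ g : Spacetime → ℝ} (hf : IsSmooth f) (hf₁ : IsSmooth f₁)
    (hg : IsSmooth g) (h : extD f = extD f₁) :
    ∫ x : UnitAddCircle, f (0, x) * partialTheta g (0, x) =
      ∫ x : UnitAddCircle, f₁ (0, x) * partialTheta g (0, x) := by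
  have hc : ∀ p, f p = f₁ p + (f - f₁) 0 := fun p => by
    have := (hf.sub hf₁).eq_const (by rw [hf.extD_sub hf₁, h, sub_self]) p
    rw [← this]; simp
  have i1 : Integrable (fun x : UnitAddCircle => f₁ (0, x) * partialTheta g (0, x)) volume :=
    integrable_of_continuous ((hf₁.continuous_slice 0).mul (hg.continuous_partialTheta 0))
  have i2 : Integrable (fun x : UnitAddCircle => (f - f₁) 0 * partialTheta g (0, x)) volume :=
    integrable_of_continuous (continuous_const.mul (hg.continuous_partialTheta 0))
  calc ∫ x : UnitAddCircle, f (0, x) * partialTheta g (0, x)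
      = ∫ x : UnitAddCircle, (f₁ (0, x) * partialTheta g (0, x) +
          (f - f₁) 0 * partialTheta g (0, x)) := by
        congr 1
        funext x
        rw [hc, add_mul]
    _ = _ := by
        rw [integral_add i1 i2, integral_const_mul, hg.integral_partialTheta, mul_zero, add_zero]

namespace IsPotentialPair

variable {f f' f₁ f₁' g g' g₁ g₁' : Spacetime → ℝ} {η θ : OneForm}

theorem extD_right (h : IsPotentialPair f f' η) : extD f' = hodge η := by
  rw [← h.hodge_extD_right, hodge_hodge]

theorem add (h : IsPotentialPair f f' η) (k : IsPotentialPair g g' θ) :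
    IsPotentialPair (f + g) (f' + g') (η + θ) where
  smooth_left := h.smooth_left.add k.smooth_left
  smooth_right := h.smooth_right.add k.smooth_right
  extD_left := by rw [h.smooth_left.extD_add k.smooth_left, h.extD_left, k.extD_left]
  hodge_extD_right := by
    rw [h.smooth_right.extD_add k.smooth_right, map_add, h.hodge_extD_right, k.hodge_extD_right]

theorem smul (h : IsPotentialPair f f' η) (c : ℝ) :
    IsPotentialPair (c • f) (c • f') (c • η) where
  smooth_left := h.smooth_left.const_smul c
  smooth_right := h.smooth_right.const_smul c
  extD_left := by rw [h.smooth_left.extD_smul, h.extD_left]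
  hodge_extD_right := by rw [h.smooth_right.extD_smul, map_smul, h.hodge_extD_right]

theorem dual (h : IsPotentialPair f f' η) : IsPotentialPair f' f (hodge η) where
  smooth_left := h.smooth_right
  smooth_right := h.smooth_left
  extD_left := h.extD_right
  hodge_extD_right := by rw [h.extD_left]

theorem comp_add (h : IsPotentialPair f f' η) (v : Spacetime) :
    IsPotentialPair (fun p => f (p + v)) (fun p => f' (p + v)) (fun p => η (p + v)) where
  smooth_left := h.smooth_left.comp_add v
  smooth_right := h.smooth_right.comp_add v
  extD_left := by rw [extD_comp_add, h.extD_left]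
  hodge_extD_right := by
    rw [extD_comp_add, ← h.hodge_extD_right]
    rfl

theorem pairing_congr (h : IsPotentialPair f f' η) (h₁ : IsPotentialPair f₁ f₁' η)
    (k : IsPotentialPair g g' θ) (k₁ : IsPotentialPair g₁ g₁' θ) :
    pairing f f' g g' = pairing f₁ f₁' g₁ g₁' := by
  have e1 : partialTheta g = partialTheta g₁ := funext fun p =>
    congrArg Prod.snd (congrFun (k.extD_left.trans k₁.extD_left.symm) p)
  have e2 : partialTheta g' = partialTheta g₁' := funext fun p =>
    congrArg Prod.snd (congrFun (k.extD_right.trans k₁.extD_right.symm) p)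
  rw [pairing_eq h.smooth_left h.smooth_right k.smooth_left k.smooth_right,
    pairing_eq h₁.smooth_left h₁.smooth_right k₁.smooth_left k₁.smooth_right,
    integral_congr_of_extD h.smooth_right h₁.smooth_right k.smooth_left
      (h.extD_right.trans h₁.extD_right.symm),
    integral_congr_of_extD h.smooth_left h₁.smooth_left k.smooth_right
      (h.extD_left.trans h₁.extD_left.symm), e1, e2]

theorem pairing_self (h : IsPotentialPair f f' η) : pairing f f' f f' = 0 := by
  rw [← (h.smooth_right.mul h.smooth_left).integral_partialTheta 0, pairing]
  congr 1
  funext x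
  rw [h.smooth_right.partialTheta_mul h.smooth_left]
  ring

theorem add_slice (h : IsPotentialPair f f' η) (s : ℝ) (x : UnitAddCircle) :
    f (s, x) + f' (s, x) =
      f (0, x - (s : UnitAddCircle)) + f' (0, x - (s : UnitAddCircle)) := by
  have hd : ∀ u : ℝ, HasDerivAt (fun u : ℝ =>
      f (u, x - (s : UnitAddCircle) + ((1 * u : ℝ) : UnitAddCircle)) +
      f' (u, x - (s : UnitAddCircle) + ((1 * u : ℝ) : UnitAddCircle))) 0 u := fun u => by
    have h1 := (h.smooth_left.hasDerivAt_line 1 (x - (s : UnitAddCircle)) u).add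
      (h.smooth_right.hasDerivAt_line 1 (x - (s : UnitAddCircle)) u)
    have e1 := congrFun h.extD_left (u, x - (s : UnitAddCircle) + ((1 * u : ℝ) : UnitAddCircle))
    have e2 := congrFun h.extD_right (u, x - (s : UnitAddCircle) + ((1 * u : ℝ) : UnitAddCircle))
    rw [hodge_apply, ← e1] at e2
    have e3 := congrArg Prod.fst e2
    have e4 := congrArg Prod.snd e2
    simp only [extD] at e3 e4
    refine h1.congr_deriv ?_
    rw [e3, e4]
    ring
  have := is_const_of_deriv_eq_zero (fun u => (hd u).differentiableAt) (fun u => (hd u).deriv) s 0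
  simpa using this

theorem sub_slice (h : IsPotentialPair f f' η) (s : ℝ) (x : UnitAddCircle) :
    f (s, x) - f' (s, x) =
      f (0, x + (s : UnitAddCircle)) - f' (0, x + (s : UnitAddCircle)) := by
  have hd : ∀ u : ℝ, HasDerivAt (fun u : ℝ =>
      f (u, x + (s : UnitAddCircle) + ((-1 * u : ℝ) : UnitAddCircle)) -
      f' (u, x + (s : UnitAddCircle) + ((-1 * u : ℝ) : UnitAddCircle))) 0 u := fun u => by
    have h1 := (h.smooth_left.hasDerivAt_line (-1) (x + (s : UnitAddCircle)) u).sub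
      (h.smooth_right.hasDerivAt_line (-1) (x + (s : UnitAddCircle)) u)
    have e1 := congrFun h.extD_left (u, x + (s : UnitAddCircle) + ((-1 * u : ℝ) : UnitAddCircle))
    have e2 := congrFun h.extD_right (u, x + (s : UnitAddCircle) + ((-1 * u : ℝ) : UnitAddCircle))
    rw [hodge_apply, ← e1] at e2
    have e3 := congrArg Prod.fst e2
    have e4 := congrArg Prod.snd e2
    simp only [extD] at e3 e4
    refine h1.congr_deriv ?_
    rw [e3, e4]
    ring
  have := is_const_of_deriv_eq_zero (fun u => (hd u).differentiableAt) (fun u => (hd u).deriv) s 0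
  simpa using this

theorem partialTheta_add_slice (h : IsPotentialPair f f' η) (s : ℝ) (x : UnitAddCircle) :
    partialTheta f (s, x) + partialTheta f' (s, x) =
      partialTheta f (0, x - (s : UnitAddCircle)) +
        partialTheta f' (0, x - (s : UnitAddCircle)) := by
  have h1 := (h.smooth_left.differentiable_theta s x 0).hasDerivAt.add
    (h.smooth_right.differentiable_theta s x 0).hasDerivAt
  have h2 := (h.smooth_left.differentiable_theta 0 (x - (s : UnitAddCircle)) 0).hasDerivAt.add
    (h.smooth_right.differentiable_theta 0 (x - (s : UnitAddCircle)) 0).hasDerivAt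
  refine h1.unique (h2.congr_of_eventuallyEq (Filter.Eventually.of_forall fun u => ?_))
  change f (s, x + (u : UnitAddCircle)) + f' (s, x + (u : UnitAddCircle)) =
    f (0, x - (s : UnitAddCircle) + (u : UnitAddCircle)) +
      f' (0, x - (s : UnitAddCircle) + (u : UnitAddCircle))
  rw [h.add_slice s, add_sub_right_comm]

theorem partialTheta_sub_slice (h : IsPotentialPair f f' η) (s : ℝ) (x : UnitAddCircle) :
    partialTheta f (s, x) - partialTheta f' (s, x) =
      partialTheta f (0, x + (s : UnitAddCircle)) -
        partialTheta f' (0, x + (s : UnitAddCircle)) := by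
  have h1 := (h.smooth_left.differentiable_theta s x 0).hasDerivAt.sub
    (h.smooth_right.differentiable_theta s x 0).hasDerivAt
  have h2 := (h.smooth_left.differentiable_theta 0 (x + (s : UnitAddCircle)) 0).hasDerivAt.sub
    (h.smooth_right.differentiable_theta 0 (x + (s : UnitAddCircle)) 0).hasDerivAt
  refine h1.unique (h2.congr_of_eventuallyEq (Filter.Eventually.of_forall fun u => ?_))
  change f (s, x + (u : UnitAddCircle)) - f' (s, x + (u : UnitAddCircle)) =
    f (0, x + (s : UnitAddCircle) + (u : UnitAddCircle)) -
      f' (0, x + (s : UnitAddCircle) + (u : UnitAddCircle))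
  rw [h.sub_slice s, add_right_comm]

/-- The pairing does not change when both arguments are translated in time and space. -/
theorem pairing_comp_add (h : IsPotentialPair f f' η) (k : IsPotentialPair g g' θ)
    (v : Spacetime) :
    pairing (fun p => f (p + v)) (fun p => f' (p + v)) (fun p => g (p + v))
      (fun p => g' (p + v)) = pairing f f' g g' := by
  obtain ⟨s, φ⟩ := v
  set A : UnitAddCircle → ℝ := fun x =>
    (f (0, x) + f' (0, x)) * (partialTheta g (0, x) + partialTheta g' (0, x)) with hA
  set B : UnitAddCircle → ℝ := fun x =>
    (f (0, x) - f' (0, x)) * (partialTheta g (0, x) - partialTheta g' (0, x)) with hB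
  have iA : Integrable A volume := integrable_of_continuous
    (((h.smooth_left.continuous_slice 0).add (h.smooth_right.continuous_slice 0)).mul
      ((k.smooth_left.continuous_partialTheta 0).add (k.smooth_right.continuous_partialTheta 0)))
  have iB : Integrable B volume := integrable_of_continuous
    (((h.smooth_left.continuous_slice 0).sub (h.smooth_right.continuous_slice 0)).mul
      ((k.smooth_left.continuous_partialTheta 0).sub (k.smooth_right.continuous_partialTheta 0)))
  have e0 : pairing f f' g g' = ∫ x, (A x - B x) / 2 := by
    rw [pairing]
    congr 1
    funext x
    simp only [hA, hB]
    ring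
  have e1 : pairing (fun p => f (p + (s, φ))) (fun p => f' (p + (s, φ)))
      (fun p => g (p + (s, φ))) (fun p => g' (p + (s, φ))) =
      ∫ x, (A (x + (φ - (s : UnitAddCircle))) - B (x + (φ + (s : UnitAddCircle)))) / 2 := by
    rw [pairing]
    congr 1
    funext x
    have d1 : partialTheta (fun p => g (p + (s, φ))) (0, x) = partialTheta g (s, x + φ) := by
      have := congrArg Prod.snd (congrFun (extD_comp_add g (s, φ)) (0, x))
      simpa [extD] using this
    have d2 : partialTheta (fun p => g' (p + (s, φ))) (0, x) = partialTheta g' (s, x + φ) := by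
      have := congrArg Prod.snd (congrFun (extD_comp_add g' (s, φ)) (0, x))
      simpa [extD] using this
    have p1 := h.add_slice s (x + φ)
    have p2 := h.sub_slice s (x + φ)
    have p3 := k.partialTheta_add_slice s (x + φ)
    have p4 := k.partialTheta_sub_slice s (x + φ)
    simp only [hA, hB, d1, d2, Prod.mk_add_mk, zero_add, ← add_sub_assoc, ← add_assoc,
      ← p1, ← p2, ← p3, ← p4]
    ring
  rw [e0, e1, integral_div, integral_div, integral_sub (iA.comp_add_right _) (iB.comp_add_right _),
    integral_sub iA iB, integral_add_right_eq_self, integral_add_right_eq_self]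

end IsPotentialPair

theorem pairing_add_left {f f' f₁ f₁' g g' : Spacetime → ℝ} {η η₁ θ : OneForm}
    (h : IsPotentialPair f f' η) (h₁ : IsPotentialPair f₁ f₁' η₁) (k : IsPotentialPair g g' θ) :
    pairing (f + f₁) (f' + f₁') g g' = pairing f f' g g' + pairing f₁ f₁' g g' := by
  rw [pairing, pairing, pairing, ← integral_add]
  · congr 1
    funext x
    simp only [Pi.add_apply]
    ring
  · exact integrable_of_continuous
      (((h.smooth_right.continuous_slice 0).mul (k.smooth_left.continuous_partialTheta 0)).add
        ((h.smooth_left.continuous_slice 0).mul (k.smooth_right.continuous_partialTheta 0)))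
  · exact integrable_of_continuous
      (((h₁.smooth_right.continuous_slice 0).mul (k.smooth_left.continuous_partialTheta 0)).add
        ((h₁.smooth_left.continuous_slice 0).mul (k.smooth_right.continuous_partialTheta 0)))

theorem pairing_smul_left (c : ℝ) (f f' g g' : Spacetime → ℝ) :
    pairing (c • f) (c • f') g g' = c * pairing f f' g g' := by
  rw [pairing, pairing, ← integral_const_mul]
  congr 1
  funext x
  simp only [Pi.smul_apply, smul_eq_mul]
  ring

theorem pairing_add_right {f f' g g' g₁ g₁' : Spacetime → ℝ} {η θ θ₁ : OneForm}
    (h : IsPotentialPair f f' η) (k : IsPotentialPair g g' θ) (k₁ : IsPotentialPair g₁ g₁' θ₁) :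
    pairing f f' (g + g₁) (g' + g₁') = pairing f f' g g' + pairing f f' g₁ g₁' := by
  have e1 : ∀ p, partialTheta (g + g₁) p = partialTheta g p + partialTheta g₁ p := fun p =>
    congrArg Prod.snd (congrFun (k.smooth_left.extD_add k₁.smooth_left) p)
  have e2 : ∀ p, partialTheta (g' + g₁') p = partialTheta g' p + partialTheta g₁' p := fun p =>
    congrArg Prod.snd (congrFun (k.smooth_right.extD_add k₁.smooth_right) p)
  rw [pairing, pairing, pairing, ← integral_add]
  · congr 1
    funext x
    rw [e1, e2]
    ring
  · exact integrable_of_continuous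
      (((h.smooth_right.continuous_slice 0).mul (k.smooth_left.continuous_partialTheta 0)).add
        ((h.smooth_left.continuous_slice 0).mul (k.smooth_right.continuous_partialTheta 0)))
  · exact integrable_of_continuous
      (((h.smooth_right.continuous_slice 0).mul (k₁.smooth_left.continuous_partialTheta 0)).add
        ((h.smooth_left.continuous_slice 0).mul (k₁.smooth_right.continuous_partialTheta 0)))

theorem pairing_smul_right (c : ℝ) {f f' g g' : Spacetime → ℝ} {θ : OneForm}
    (k : IsPotentialPair g g' θ) :
    pairing f f' (c • g) (c • g') = c * pairing f f' g g' := by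
  have e1 : ∀ p, partialTheta (c • g) p = c * partialTheta g p := fun p =>
    congrArg Prod.snd (congrFun (k.smooth_left.extD_smul c) p)
  have e2 : ∀ p, partialTheta (c • g') p = c * partialTheta g' p := fun p =>
    congrArg Prod.snd (congrFun (k.smooth_right.extD_smul c) p)
  rw [pairing, pairing, ← integral_const_mul]
  congr 1
  funext x
  rw [e1, e2]
  ring

/-- The space `dC^∞ ∩ *dC^∞(M)` of the dynamical sector. -/
def dynSector : Submodule ℝ OneForm where
  carrier := {η | ∃ f f', IsPotentialPair f f' η}
  zero_mem' := ⟨0 • 0, 0 • 0, by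
    have h0 : extD 0 = 0 := by
      have := IsSmooth.zero.extD_smul 0
      simpa using this
    refine ⟨by simpa using IsSmooth.zero, by simpa using IsSmooth.zero, ?_, ?_⟩ <;> simp [h0]⟩
  add_mem' := by
    rintro _ _ ⟨f, f', h⟩ ⟨g, g', k⟩
    exact ⟨_, _, h.add k⟩
  smul_mem' := by
    rintro c _ ⟨f, f', h⟩
    exact ⟨_, _, h.smul c⟩

/-- A potential `A` of `η = dA = *dÃ`. -/
def potential (η : dynSector) : Spacetime → ℝ := η.2.choose

/-- A dual potential `Ã` of `η = dA = *dÃ`. -/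
def dualPotential (η : dynSector) : Spacetime → ℝ := η.2.choose_spec.choose

theorem isPotentialPair (η : dynSector) :
    IsPotentialPair (potential η) (dualPotential η) (η : OneForm) := η.2.choose_spec.choose_spec

/-- The form `(dA = *dÃ, dA' = *dÃ') ↦ ∫_Σ (Ã dA' + A dÃ')`; by `tauReal_eq` the choice of the
potentials does not matter. -/
def tauReal : dynSector →ₗ[ℝ] dynSector →ₗ[ℝ] ℝ :=
  LinearMap.mk₂ ℝ
    (fun η θ => pairing (potential η) (dualPotential η) (potential θ) (dualPotential θ))
    (fun η η₁ θ => by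
      rw [(isPotentialPair (η + η₁)).pairing_congr
        ((isPotentialPair η).add (isPotentialPair η₁)) (isPotentialPair θ) (isPotentialPair θ)]
      exact pairing_add_left (isPotentialPair η) (isPotentialPair η₁) (isPotentialPair θ))
    (fun c η θ => by
      rw [(isPotentialPair (c • η)).pairing_congr
        ((isPotentialPair η).smul c) (isPotentialPair θ) (isPotentialPair θ)]
      exact pairing_smul_left c _ _ _ _)
    (fun η θ θ₁ => by
      rw [(isPotentialPair η).pairing_congr (isPotentialPair η) (isPotentialPair (θ + θ₁))
        ((isPotentialPair θ).add (isPotentialPair θ₁))]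
      exact pairing_add_right (isPotentialPair η) (isPotentialPair θ) (isPotentialPair θ₁))
    (fun c η θ => by
      rw [(isPotentialPair η).pairing_congr (isPotentialPair η) (isPotentialPair (c • θ))
        ((isPotentialPair θ).smul c)]
      exact pairing_smul_right c (isPotentialPair θ))

theorem tauReal_eq {η θ : dynSector} {f f' g g' : Spacetime → ℝ}
    (h : IsPotentialPair f f' (η : OneForm)) (k : IsPotentialPair g g' (θ : OneForm)) :
    tauReal η θ = pairing f f' g g' :=
  (isPotentialPair η).pairing_congr h (isPotentialPair θ) k

theorem tauReal_self (η : dynSector) : tauReal η η = 0 := (isPotentialPair η).pairing_self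

/-- The pre-symplectic form `κ τ_u`, where `τ_u` is `tauReal` modulo `ℤ`. -/
def tau (κ : ℝ) : PresymplecticForm dynSector where
  toHom := AddMonoidHom.mk' (fun η => AddMonoidHom.mk'
    (fun θ => ((κ * tauReal η θ : ℝ) : UnitAddCircle))
    (fun θ θ₁ => by rw [map_add, mul_add, AddCircle.coe_add]))
    (fun η η₁ => by
      ext θ
      simp only [AddMonoidHom.mk'_apply, AddMonoidHom.add_apply]
      rw [map_add, LinearMap.add_apply, mul_add, AddCircle.coe_add])
  self_eq_zero η := by
    simp only [AddMonoidHom.mk'_apply]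
    rw [tauReal_self, mul_zero, AddCircle.coe_zero]

theorem tau_apply (κ : ℝ) (η θ : dynSector) :
    (tau κ).toHom η θ = ((κ * tauReal η θ : ℝ) : UnitAddCircle) := rfl

/-- The duality `ζ_u : (dA = *dÃ) ↦ (dÃ = *dA)`. As `** = 1` on one-forms, it is `η ↦ *η`. -/
def duality : dynSector ≃+ dynSector where
  toFun η := ⟨hodge η, _, _, (isPotentialPair η).dual⟩
  invFun η := ⟨hodge η, _, _, (isPotentialPair η).dual⟩
  left_inv _ := Subtype.ext (hodge_hodge _)
  right_inv _ := Subtype.ext (hodge_hodge _)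
  map_add' _ _ := Subtype.ext (map_add hodge _ _)

theorem duality_eq {η : dynSector} {f f' : Spacetime → ℝ}
    (h : IsPotentialPair f f' (η : OneForm)) :
    (duality η : OneForm) = extD f' ∧ (duality η : OneForm) = hodge (extD f) :=
  ⟨h.extD_right.symm, by rw [h.extD_left]; rfl⟩

theorem tau_duality (κ : ℝ) (η θ : dynSector) :
    (tau κ).toHom (duality η) (duality θ) = (tau κ).toHom η θ := by
  rw [tau_apply, tau_apply, tauReal_eq (η := duality η) (isPotentialPair η).dual
    (θ := duality θ) (isPotentialPair θ).dual, tauReal_eq (isPotentialPair η) (isPotentialPair θ)]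
  simp only [pairing, add_comm]

/-- The translation `β_{(s,φ)} : η ↦ η(· + s, · + φ)`. -/
def translate (v : Spacetime) : dynSector ≃+ dynSector where
  toFun η := ⟨fun p => (η : OneForm) (p + v), _, _, (isPotentialPair η).comp_add v⟩
  invFun η := ⟨fun p => (η : OneForm) (p + -v), _, _, (isPotentialPair η).comp_add (-v)⟩
  left_inv _ := Subtype.ext (by funext p; simp)
  right_inv _ := Subtype.ext (by funext p; simp)
  map_add' _ _ := rfl

theorem tau_translate (κ : ℝ) (v : Spacetime) (η θ : dynSector) :
    (tau κ).toHom (translate v η) (translate v θ) = (tau κ).toHom η θ := by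
  rw [tau_apply, tau_apply, tauReal_eq (η := translate v η) ((isPotentialPair η).comp_add v)
    (θ := translate v θ) ((isPotentialPair θ).comp_add v),
    tauReal_eq (isPotentialPair η) (isPotentialPair θ),
    (isPotentialPair η).pairing_comp_add (isPotentialPair θ)]

/-- The coefficient `2 ∫₀¹ f(0, θ) cos(2πkθ) dθ` of `cos(2πkθ)` in the Fourier series of
`f` at time `0`. -/
def cosCoeff (f : Spacetime → ℝ) (k : ℕ) : ℝ :=
  2 * ∫ y in (0 : ℝ)..1, f (0, (y : UnitAddCircle)) * Real.cos (2 * Real.pi * k * y)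

/-- The coefficient `2 ∫₀¹ f(0, θ) sin(2πkθ) dθ` of `sin(2πkθ)` in the Fourier series of
`f` at time `0`. -/
def sinCoeff (f : Spacetime → ℝ) (k : ℕ) : ℝ :=
  2 * ∫ y in (0 : ℝ)..1, f (0, (y : UnitAddCircle)) * Real.sin (2 * Real.pi * k * y)

/-- The coefficient `a_k⁺` in the expansions, up to additive constants, of the potentials of
`dφ = *dφ̃`:
`φ = ∑ (- b_k⁻ cos 2πk(t-θ) - b_k⁺ cos 2πk(t+θ) + a_k⁻ sin 2πk(t-θ) + a_k⁺ sin 2πk(t+θ))`,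
`φ̃ = ∑ (- b_k⁻ cos 2πk(t-θ) + b_k⁺ cos 2πk(t+θ) + a_k⁻ sin 2πk(t-θ) - a_k⁺ sin 2πk(t+θ))`.
At `t = 0` these read
`φ = ∑ ((- b_k⁻ - b_k⁺) cos 2πkθ + (a_k⁺ - a_k⁻) sin 2πkθ)`,
`φ̃ = ∑ ((b_k⁺ - b_k⁻) cos 2πkθ + (- a_k⁺ - a_k⁻) sin 2πkθ)`,
which is solved here for the four coefficients. -/
def aPlus (η : dynSector) (k : ℕ) : ℝ :=
  (sinCoeff (potential η) k - sinCoeff (dualPotential η) k) / 2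

/-- The coefficient `a_k⁻`, see `aPlus`. -/
def aMinus (η : dynSector) (k : ℕ) : ℝ :=
  -(sinCoeff (potential η) k + sinCoeff (dualPotential η) k) / 2

/-- The coefficient `b_k⁺`, see `aPlus`. -/
def bPlus (η : dynSector) (k : ℕ) : ℝ :=
  (cosCoeff (dualPotential η) k - cosCoeff (potential η) k) / 2

/-- The coefficient `b_k⁻`, see `aPlus`. -/
def bMinus (η : dynSector) (k : ℕ) : ℝ :=
  -(cosCoeff (potential η) k + cosCoeff (dualPotential η) k) / 2

/-- The symmetric bilinear form
`μ(dφ, dφ') = ∑_{k ≥ 1} πk (a_k⁺ a_k⁺' + b_k⁺ b_k⁺' + a_k⁻ a_k⁻' + b_k⁻ b_k⁻')`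
selected by the positive frequencies. -/
def mu (η θ : dynSector) : ℝ :=
  ∑' k : ℕ+, Real.pi * k * (aPlus η k * aPlus θ k + bPlus η k * bPlus θ k +
    aMinus η k * aMinus θ k + bMinus η k * bMinus θ k)

/-- The C⋆-algebra of the dynamical sector, with Weyl relations
`W(η) W(θ) = exp (2πi κ τ_u(η, θ)) W(η + θ)`; for `κ = 1` this is `CCR(dC^∞ ∩ *dC^∞, τ_u)`. -/
abbrev DynAlgebra (κ : ℝ) : Type := CCR (tau κ)

/-- The automorphism `W(dA = *dÃ) ↦ W(dÃ = *dA)` implementing the duality. -/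
def dualityAut (κ : ℝ) : DynAlgebra κ ≃⋆ₐ[ℂ] DynAlgebra κ :=
  CCR.equiv duality (tau_duality κ)

/-- The automorphism `α_{(s,φ)} : W(η) ↦ W(β_{(s,φ)} η)` implementing the spacetime symmetry
`(t, θ) ↦ (t + s, θ + φ)`. -/
def symmetryAut (κ : ℝ) (v : Spacetime) : DynAlgebra κ ≃⋆ₐ[ℂ] DynAlgebra κ :=
  CCR.equiv (translate v) (tau_translate κ v)

/-- `ω` is a state on the algebra of the dynamical sector with
`ω(W(η)) = exp (- (r / 2) μ(η, η))`. -/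
structure IsOmegaMu (κ r : ℝ) (ω : DynAlgebra κ →ₗ[ℂ] ℂ) : Prop where
  isState : IsState ω
  apply_W : ∀ η : dynSector,
    ω (CCR.W (tau κ) η) = (Real.exp (-(r / 2) * mu η η) : ℂ)

end Cylinder

section GNS

variable {A : Type*} [CStarAlgebra A] {H : Type*} [NormedAddCommGroup H]
  [InnerProductSpace ℂ H] [CompleteSpace H]

/-- `(H, π, Ψ)` is a GNS triple of `ω`: the vector `Ψ` is cyclic for the representation `π`, and
`ω` is its vector state. -/
structure IsGNSTriple (ω : A →ₗ[ℂ] ℂ) (π : A →⋆ₐ[ℂ] (H →L[ℂ] H)) (Ψ : H) : Prop where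
  cyclic : Dense (Set.range fun a : A => π a Ψ)
  inner_eq : ∀ a : A, inner ℂ Ψ (π a Ψ) = ω a

/-- The unitary operator `V` implements the automorphism `α` in the representation `π` with
cyclic vector `Ψ`: it maps the vector `[a] = π(a)Ψ` of an observable `a` to `[α(a)]`, and
`V π(a) = π(α(a)) V`. -/
structure Implements (π : A →⋆ₐ[ℂ] (H →L[ℂ] H)) (Ψ : H) (α : A ≃⋆ₐ[ℂ] A)
    (V : H ≃ₗᵢ[ℂ] H) : Prop where
  map_vector : ∀ a : A, V (π a Ψ) = π (α a) Ψ
  intertwines : ∀ (a : A) (ξ : H), V (π a ξ) = π (α a) (V ξ)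

end GNS

end

/-! Everything rests on a twisted kernel. A function `g` on the group defines a functional `W(x) ↦
g(x)` on the span of the Weyl elements, and its value at `a⋆ a` is the quadratic form of the kernel
`exp(2πi κτ(-x, y)) g(y - x)`. For the Gaussian `g = exp(-(r/2) μ)`, polarization of `μ` writes this
kernel as `u(x) u(y) exp(r μ(x, y) - 2πi κτ(x, y))` with `u = g` real. The Schur product theorem
preserves positivity under entrywise products, hence under the entrywise exponential, so it suffices
that the sesquilinear form `r μ - 2πi κτ` is positive (`posSemidef_kernel`).

That is seen in Fourier modes. A form in the dynamical sector splits into a right-moving part `φ +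
φ̃` and a left-moving part `φ - φ̃`. If `z_k` denotes the Hermitian product of the `k`-th modes of
the derivatives (`modeProd`, left movers conjugated), then `μ = ∑ Re z_k / (4πk)` (`hasSum_mu`) and
`τ = -∑ Im z_k / (2πk)` (`hasSum_tauReal`). Hence `r μ - 2πi κτ` is the sum over `k ≥ 1` of
`(4πk)⁻¹` times `((r + 4πκ)/2) z_k + ((r - 4πκ)/2) conj z_k`. Both `z_k` and its conjugate are
positive kernels, and both coefficients are nonnegative exactly when `r ≥ 4π|κ|`.

The state extends to the completion because every state is bounded by the norm, and it is unique
because states on a C⋆-algebra are continuous while the Weyl elements span a dense subspace.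
Uniqueness also gives invariance: an automorphism induced by a map preserving `τ` and the quadratic
form `μ(η, η)` must preserve the state. The duality fixes right modes and negates left modes, and
translations multiply modes by phases, so both preserve `μ(η, η)`.

An invariant state makes `π(a)Ψ ↦ π(α a)Ψ` isometric on a dense subspace, which yields the unitary.
An implementer is determined by its automorphism, so the group law and the commutation of `V` with
`U` follow from the same relations between maps of one-forms. -/

noncomputable section

open scoped ComplexOrder Matrix

/-! ### Schur products and exponentials of positive semidefinite kernels -/

namespace Matrix.PosSemidef

variable {n : Type*}

/-- An entrywise convergent series of positive semidefinite matrices is positive semidefinite. -/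
theorem of_hasSum {ι : Type*} {A : ι → Matrix n n ℂ} {M : Matrix n n ℂ}
    (hA : ∀ k, (A k).PosSemidef) (h : ∀ i j, HasSum (fun k => A k i j) (M i j)) :
    M.PosSemidef := by
  refine ⟨?_, fun x => ?_⟩
  · ext i j
    refine ((h j i).star).unique ?_
    simpa only [(hA _).isHermitian.apply] using h i j
  -- The test vector has finite support, so entrywise convergence already gives convergence of the
  -- quadratic form.
  · have hs : HasSum (fun k => x.sum fun i xi => x.sum fun j xj => star xi * A k i j * xj)
        (x.sum fun i xi => x.sum fun j xj => star xi * M i j * xj) :=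
      hasSum_sum fun i _ => hasSum_sum fun j _ => ((h i j).mul_left _).mul_right _
    exact hs.nonneg fun k => (hA k).2 x

/-- The Gram matrix of complex numbers. -/
theorem star_mul_self (u : n → ℂ) : (of fun i j => star (u i) * u j).PosSemidef := by
  refine ⟨by ext i j; simp [mul_comm], fun x => ?_⟩
  -- The form is the squared modulus of the single number `∑ u_j x_j`.
  have : (x.sum fun i xi => x.sum fun j xj => star xi * (star (u i) * u j) * xj) =
      star (x.sum fun i xi => u i * xi) * x.sum fun j xj => u j * xj := by
    simp only [Finsupp.sum, star_sum, Finset.sum_mul_sum, star_mul']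
    refine Finset.sum_congr rfl fun i _ => Finset.sum_congr rfl fun j _ => ?_
    ring
  simp only [of_apply, this]
  exact star_mul_self_nonneg _

/-- Schur product theorem, iterated. The zeroth power is the all-ones matrix, which is the Gram
matrix of the constant `1`. -/
theorem map_pow {A : Matrix n n ℂ} (hA : A.PosSemidef) (k : ℕ) : (A.map (· ^ k)).PosSemidef := by
  induction k with
  | zero => simpa [Matrix.map] using star_mul_self (fun _ : n => (1 : ℂ))
  | succ k ih =>
    have h : A.map (· ^ (k + 1)) = A.map (· ^ k) ⊙ A := by
      ext i j
      exact pow_succ (A i j) k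
    rw [h]
    exact ih.hadamard hA

/-- The entrywise exponential of a positive semidefinite matrix is positive semidefinite. -/
theorem map_exp {A : Matrix n n ℂ} (hA : A.PosSemidef) : (A.map Complex.exp).PosSemidef := by
  -- The exponential series has nonnegative coefficients `1/k!`.
  refine of_hasSum (A := fun k : ℕ => ((k.factorial : ℝ)⁻¹) • A.map (· ^ k))
    (fun k => (hA.map_pow k).smul (by positivity)) fun i j => ?_
  have h := NormedSpace.expSeries_div_hasSum_exp (A i j)
  rw [← Complex.exp_eq_exp_ℂ] at h
  have e : (fun k : ℕ => (((k.factorial : ℝ)⁻¹) • A.map (· ^ k)) i j) =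
      fun k : ℕ => A i j ^ k / (k.factorial : ℂ) := by
    funext k
    rw [Matrix.smul_apply, Matrix.map_apply, Complex.real_smul, div_eq_inv_mul]
    push_cast
    rfl
  exact e ▸ h

end Matrix.PosSemidef

/-! ### Functionals on the span of the Weyl elements -/

namespace WeylAlg

variable {G : Type*} [AddCommGroup G] {τ : PresymplecticForm G}

theorem lift_star_mul_self (g : G → ℂ) (a : WeylAlg τ) :
    (lift g : WeylAlg τ →ₗ[ℂ] ℂ) (star a * a) =
      Finsupp.sum (M := ℂ) a fun x c => Finsupp.sum (M := ℂ) a fun y d =>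
        star c * (τ.phase (-x) y * g (y - x)) * d := by
  -- Generalized to two independent elements, so that each factor is expanded in the Weyl generators
  -- separately.
  have key : ∀ a b : WeylAlg τ, (lift g : WeylAlg τ →ₗ[ℂ] ℂ) (star a * b) =
      Finsupp.sum (M := ℂ) a fun x c => Finsupp.sum (M := ℂ) b fun y d =>
        star c * (τ.phase (-x) y * g (y - x)) * d := by
    intro a b
    have e : ∀ a : WeylAlg τ, a = Finsupp.sum (M := ℂ) a fun x c => c • W τ x := fun a =>
      (Finsupp.sum_single (M := ℂ) a).symm.trans
        (Finsupp.sum_congr fun x _ => by exact (Finsupp.smul_single_one x _).symm)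
    conv_lhs => rw [e a, e b]
    simp only [Finsupp.sum, star_sum, Finset.sum_mul_sum, map_sum]
    refine Finset.sum_congr rfl fun x _ => Finset.sum_congr rfl fun y _ => ?_
    rw [star_smul_W, smul_mul', mul_smul', W_mul_W, map_smul, map_smul, map_smul, lift_W,
      neg_add_eq_sub]
    simp only [smul_eq_mul]
    ring
  exact key a a

/-- A normalized function `g` defines a state by `W(x) ↦ g(x)` if the twisted kernel
`exp (2πi τ(-x, y)) g(y - x)` is positive semidefinite. -/
theorem isState_lift {g : G → ℂ} (h0 : g 0 = 1)
    (hg : (Matrix.of fun x y => τ.phase (-x) y * g (y - x)).PosSemidef) :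
    IsState (lift g : WeylAlg τ →ₗ[ℂ] ℂ) := by
  have h : ∀ a, 0 ≤ (lift g : WeylAlg τ →ₗ[ℂ] ℂ) (star a * a) := fun a => by
    rw [lift_star_mul_self]
    exact hg.2 a
  exact ⟨fun a => (Complex.nonneg_iff.1 (h a)).1, fun a => (Complex.nonneg_iff.1 (h a)).2.symm,
    by rw [one_def, lift_W, h0]⟩

end WeylAlg

/-! ### States on C⋆-algebras and extension from the Weyl span -/

namespace IsState

/-- A state on a C⋆-algebra is continuous. -/
theorem continuous {A : Type*} [CStarAlgebra A] {ω : A →ₗ[ℂ] ℂ} (hω : IsState ω) :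
    Continuous ω := by
  let := CStarAlgebra.spectralOrder A
  let := CStarAlgebra.spectralOrderedRing A
  refine (ω.mkContinuous 1 fun a => ?_).continuous
  -- In the spectral order `a⋆ a ≤ ‖a‖² 1`, so the difference has the form `b⋆ b` and positivity of
  -- `ω` applies to it.
  have h1 : (ω (star a * a)).re ≤ ‖a‖ ^ 2 := by
    obtain ⟨b, hb⟩ := CStarAlgebra.nonneg_iff_eq_star_mul_self.1
      (sub_nonneg.2 (CStarAlgebra.star_mul_le_algebraMap_norm_sq (a := a)))
    have h := hω.re_nonneg b
    have e : (algebraMap ℝ A (‖a‖ ^ 2)) = ((‖a‖ ^ 2 : ℝ) : ℂ) • (1 : A) := by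
      rw [Algebra.algebraMap_eq_smul_one, Complex.coe_smul]
    rw [← hb, e, map_sub, map_smul, hω.map_one, smul_eq_mul, mul_one, Complex.sub_re,
      Complex.ofReal_re] at h
    linarith
  -- Cauchy–Schwarz against the unit turns the bound on `ω(a⋆ a)` into one on `|ω(a)|`.
  have h2 := hω.norm_apply_le 1 a
  have e1 : stateNorm ω 1 = 1 := by simp [stateNorm, hω.map_one]
  rw [star_one, one_mul, e1, one_mul] at h2
  rw [one_mul]
  exact h2.trans (Real.sqrt_le_iff.2 ⟨norm_nonneg _, h1⟩)

theorem comp_starAlgEquiv {A : Type*} [CStarAlgebra A] {ω : A →ₗ[ℂ] ℂ} (hω : IsState ω)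
    (α : A ≃⋆ₐ[ℂ] A) : IsState (ω ∘ₗ (α : A →⋆ₐ[ℂ] A).toAlgHom.toLinearMap) where
  re_nonneg a := by simpa [map_star] using hω.re_nonneg (α a)
  im_eq_zero a := by simpa [map_star] using hω.im_eq_zero (α a)
  map_one := by simpa using hω.map_one

end IsState

namespace CCR

variable {G : Type*} [AddCommGroup G] {τ : PresymplecticForm G}

/-- Continuous linear maps on `CCR(G, τ)` are determined by their values on the Weyl elements. -/
theorem linearMap_ext {F : Type*} [NormedAddCommGroup F] [Module ℂ F] {f g : CCR τ →ₗ[ℂ] F}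
    (hf : Continuous f) (hg : Continuous g) (h : ∀ x, f (W τ x) = g (W τ x)) : f = g := by
  ext a
  refine induction (isClosed_eq hf hg) (fun a => ?_) a
  induction a using WeylAlg.induction with
  | h0 => rw [ofWeyl_zero, map_zero, map_zero]
  | hadd a b ha hb => rw [ofWeyl_add, map_add, map_add, ha, hb]
  | hW c x => rw [ofWeyl_smul, map_smul, map_smul]; exact congrArg (c • ·) (h x)

/-- A state on the span of the Weyl elements extends to `CCR(G, τ)`. -/
theorem exists_isState_extension {ω : WeylAlg τ →ₗ[ℂ] ℂ} (hω : IsState ω) :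
    ∃ ω' : CCR τ →ₗ[ℂ] ℂ, IsState ω' ∧ ∀ a, ω' (ofWeyl a) = ω a := by
  -- The norm is a supremum over all states, so `√ω(a⋆ a)` is one of its competitors; Cauchy–Schwarz
  -- does the rest.
  have hb : ∀ a, ‖ω a‖ ≤ 1 * ‖a‖ := fun a => by
    have h := hω.norm_apply_le 1 a
    have e1 : stateNorm ω 1 = 1 := WeylAlg.stateNorm_W hω 0
    rw [star_one, one_mul, e1] at h
    exact h.trans (mul_le_mul_of_nonneg_left (WeylAlg.stateNorm_le hω a) zero_le_one)
  let e : WeylAlg τ →ₗ[ℂ] CCR τ := ⟨⟨ofWeyl, ofWeyl_add⟩, ofWeyl_smul⟩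
  have he : ∀ a, ω.extendOfNorm e (ofWeyl a) = ω a := fun a =>
    LinearMap.extendOfNorm_eq (e := e) denseRange_ofWeyl
      ⟨1, fun a => (hb a).trans_eq (by rw [← norm_ofWeyl]; rfl)⟩ a
  -- Positivity is a closed condition on `a`, so it passes from the dense span to the completion.
  have hc : Continuous fun a : CCR τ => ω.extendOfNorm e (star a * a) :=
    (ω.extendOfNorm e).continuous.comp (continuous_star'.mul continuous_id)
  refine ⟨(ω.extendOfNorm e).toLinearMap, ⟨fun a => ?_, fun a => ?_, ?_⟩, he⟩
  · refine induction (isClosed_le continuous_const (Complex.continuous_re.comp hc)) (fun a => ?_) a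
    simp only [star_ofWeyl, ← ofWeyl_mul, Function.comp_apply, he]
    exact hω.re_nonneg a
  · refine induction (isClosed_eq (Complex.continuous_im.comp hc) continuous_const) (fun a => ?_) a
    simp only [star_ofWeyl, ← ofWeyl_mul, Function.comp_apply, he]
    exact hω.im_eq_zero a
  · exact (he 1).trans hω.map_one

end CCR

/-! ### Unitary implementation in the GNS representation -/

namespace IsGNSTriple

variable {A : Type*} [CStarAlgebra A] {H : Type*} [NormedAddCommGroup H]
  [InnerProductSpace ℂ H] [CompleteSpace H] {ω : A →ₗ[ℂ] ℂ} {π : A →⋆ₐ[ℂ] (H →L[ℂ] H)} {Ψ : H}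

theorem norm_sq_apply (h : IsGNSTriple ω π Ψ) (a : A) :
    ((‖π a Ψ‖ ^ 2 : ℝ) : ℂ) = ω (star a * a) := by
  rw [← h.inner_eq, map_mul, map_star, mul_apply_eq_comp,
    ContinuousLinearMap.star_eq_adjoint, ContinuousLinearMap.adjoint_inner_right,
    inner_self_eq_norm_sq_to_K]
  norm_cast

/-- An automorphism which preserves a state is implemented by a unitary operator. -/
theorem exists_implements (h : IsGNSTriple ω π Ψ) (α : A ≃⋆ₐ[ℂ] A) (hα : ∀ a, ω (α a) = ω a) :
    ∃ V : H ≃ₗᵢ[ℂ] H, Implements π Ψ α V := by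
  let e : A →ₗ[ℂ] H := (LinearMap.applyₗ Ψ) ∘ₗ (ContinuousLinearMap.coeLM ℂ) ∘ₗ
    π.toAlgHom.toLinearMap
  have he : ∀ a, e a = π a Ψ := fun a => rfl
  have hd : DenseRange e := h.cyclic
  let f : A ≃ₗ[ℂ] A := α.toAlgEquiv.toLinearEquiv
  -- The squared norm of `π(a)Ψ` is `ω(a⋆ a)`, which `α` leaves unchanged. In particular the map on
  -- vectors is well defined.
  have hn : ∀ a, ‖e (f a)‖ = ‖e a‖ := fun a => by
    have h1 := h.norm_sq_apply (α a)
    rw [← map_star, ← map_mul, hα, ← h.norm_sq_apply, Complex.ofReal_inj] at h1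
    exact (pow_left_inj₀ (norm_nonneg _) (norm_nonneg _) two_ne_zero).1 h1
  have hV : ∀ a, f.extendOfIsometry e e hd hd hn (π a Ψ) = π (α a) Ψ :=
    f.extendOfIsometry_eq e e hd hd hn
  refine ⟨f.extendOfIsometry e e hd hd hn, hV, fun a => ?_⟩
  -- On `ξ = π(b)Ψ` the intertwining relation is multiplicativity of `α` and `π`; density does the
  -- rest.
  refine hd.induction (fun ξ hξ => ?_) (isClosed_eq (by fun_prop) (by fun_prop))
  obtain ⟨b, rfl⟩ := hξ
  rw [he, ← mul_apply_eq_comp, ← map_mul, hV, hV, map_mul, map_mul]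
  rfl

/-- Cyclicity determines the operator. This is what carries identities between automorphisms over to
identities between unitaries, without phase ambiguity since `Ψ` is fixed. -/
theorem implements_unique (h : IsGNSTriple ω π Ψ) {α : A ≃⋆ₐ[ℂ] A} {V V' : H ≃ₗᵢ[ℂ] H}
    (hV : Implements π Ψ α V) (hV' : Implements π Ψ α V') : V = V' := by
  have hd : DenseRange fun a => π a Ψ := h.cyclic
  ext ξ
  refine hd.induction_on ξ (isClosed_eq V.continuous V'.continuous) fun a => ?_
  rw [hV.map_vector, hV'.map_vector]

end IsGNSTriple

theorem Implements.mul {A : Type*} [CStarAlgebra A] {H : Type*} [NormedAddCommGroup H]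
    [InnerProductSpace ℂ H] [CompleteSpace H] {π : A →⋆ₐ[ℂ] (H →L[ℂ] H)} {Ψ : H}
    {α β γ : A ≃⋆ₐ[ℂ] A} {V W : H ≃ₗᵢ[ℂ] H} (hV : Implements π Ψ α V) (hW : Implements π Ψ β W)
    (h : ∀ a, α (β a) = γ a) : Implements π Ψ γ (V * W) where
  map_vector a := by
    rw [LinearIsometryEquiv.coe_mul, Function.comp_apply, hW.map_vector, hV.map_vector, h]
  intertwines a ξ := by
    simp only [LinearIsometryEquiv.coe_mul, Function.comp_apply, hW.intertwines, hV.intertwines, h]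

/-! ### Fourier analysis on the time-zero circle -/

namespace Cylinder

open MeasureTheory

/-- Parseval's identity for the product of two real functions on the circle. -/
theorem hasSum_star_fourierCoeff_mul {u v : UnitAddCircle → ℝ} (hu : Continuous u)
    (hv : Continuous v) :
    HasSum (fun n : ℤ => star (fourierCoeff (fun x => (u x : ℂ)) n) *
      fourierCoeff (fun x => (v x : ℂ)) n) ((∫ x, u x * v x : ℝ) : ℂ) := by
  let U : C(UnitAddCircle, ℂ) := ⟨fun x => (u x : ℂ), Complex.continuous_ofReal.comp hu⟩
  let V : C(UnitAddCircle, ℂ) := ⟨fun x => (v x : ℂ), Complex.continuous_ofReal.comp hv⟩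
  have h := fourierBasis.hasSum_inner_mul_inner
    (ContinuousMap.toLp (E := ℂ) 2 AddCircle.haarAddCircle ℂ U)
    (ContinuousMap.toLp (E := ℂ) 2 AddCircle.haarAddCircle ℂ V)
  rw [ContinuousMap.inner_toLp] at h
  convert! h using 1
  · funext n
    rw [← HilbertBasis.repr_apply_apply, ← inner_conj_symm, ← HilbertBasis.repr_apply_apply,
      fourierBasis_repr, fourierBasis_repr, fourierCoeff_toLp, fourierCoeff_toLp]
    rfl
  · rw [AddCircle.integral_haarAddCircle, ← integral_complex_ofReal]
    simp [U, V, mul_comm]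

theorem fourierCoeff_ofReal_neg (u : UnitAddCircle → ℝ) (n : ℤ) :
    fourierCoeff (fun x => (u x : ℂ)) (-n) = star (fourierCoeff (fun x => (u x : ℂ)) n) := by
  rw [fourierCoeff, fourierCoeff, RCLike.star_def, ← integral_conj]
  congr 1
  funext x
  rw [smul_eq_mul, smul_eq_mul, map_mul, Complex.conj_ofReal, ← fourier_neg]

/-- Invariance of Haar measure and multiplicativity of the characters: rotations change modes only
by phases. -/
theorem fourierCoeff_comp_add (u : UnitAddCircle → ℂ) (c : UnitAddCircle) (n : ℤ) :
    fourierCoeff (fun x => u (x + c)) n = fourier n c * fourierCoeff u n := by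
  rw [fourierCoeff, fourierCoeff,
    ← integral_add_right_eq_self (fun x => fourier (-n) x • u x) c, ← integral_const_mul]
  congr 1
  funext x
  simp only [smul_eq_mul, fourier_apply, ← mul_assoc]
  congr 1
  rw [← Circle.coe_mul, ← AddCircle.toCircle_add]
  congr 2
  rw [smul_add, neg_smul, neg_smul]
  abel

theorem fourierCoeff_sub_of_continuous {u v : UnitAddCircle → ℂ} (hu : Continuous u)
    (hv : Continuous v) (n : ℤ) :
    fourierCoeff (fun x => u x - v x) n = fourierCoeff u n - fourierCoeff v n := by
  have i : ∀ {w : UnitAddCircle → ℂ}, Continuous w →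
      Integrable (fun x => fourier (-n) x • w x) AddCircle.haarAddCircle := fun hw =>
    ((fourier (-n)).continuous.smul hw).integrable_of_hasCompactSupport
      (HasCompactSupport.of_compactSpace _)
  rw [fourierCoeff, fourierCoeff, fourierCoeff, ← integral_sub (i hu) (i hv)]
  simp only [smul_sub]

/-- The Fourier coefficient of a function at time `0`. -/
def mode (f : Spacetime → ℝ) (n : ℤ) : ℂ := fourierCoeff (fun x => (f (0, x) : ℂ)) n

/-- Integration by parts over one period, where the boundary terms cancel. -/
theorem mode_partialTheta {f : Spacetime → ℝ} (hf : IsSmooth f) (n : ℤ) :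
    mode (partialTheta f) n = 2 * Real.pi * Complex.I * n * mode f n := by
  have hd : ∀ y : ℝ, HasDerivAt
      (fun y : ℝ => fourier (-n) (y : UnitAddCircle) * (f (0, (y : UnitAddCircle)) : ℂ))
      (fourier (-n) (y : UnitAddCircle) * (partialTheta f (0, (y : UnitAddCircle)) : ℂ) -
        2 * Real.pi * Complex.I * n *
          (fourier (-n) (y : UnitAddCircle) * (f (0, (y : UnitAddCircle)) : ℂ))) y := fun y => by
    refine ((hasDerivAt_fourier_neg 1 n y).mul
      (hf.hasDerivAt_theta_coe 0 y).ofReal_comp).congr_deriv ?_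
    simp only [Complex.ofReal_one, div_one]
    ring
  have c1 : Continuous fun y : ℝ => fourier (-n) (y : UnitAddCircle) *
      (partialTheta f (0, (y : UnitAddCircle)) : ℂ) :=
    ((fourier (-n)).continuous.mul (Complex.continuous_ofReal.comp
      (hf.continuous_partialTheta 0))).comp (AddCircle.continuous_mk' 1)
  have c2 : Continuous fun y : ℝ => fourier (-n) (y : UnitAddCircle) *
      (f (0, (y : UnitAddCircle)) : ℂ) :=
    ((fourier (-n)).continuous.mul (Complex.continuous_ofReal.comp
      (hf.continuous_slice 0))).comp (AddCircle.continuous_mk' 1)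
  have c3 : Continuous fun y : ℝ => 2 * Real.pi * Complex.I * n *
      (fourier (-n) (y : UnitAddCircle) * (f (0, (y : UnitAddCircle)) : ℂ)) :=
    continuous_const.mul c2
  have h := intervalIntegral.integral_eq_sub_of_hasDerivAt (a := 0) (b := 1) (fun y _ => hd y)
    ((c1.sub c3).intervalIntegrable _ _)
  rw [intervalIntegral.integral_sub (c1.intervalIntegrable _ _) (c3.intervalIntegrable _ _),
    intervalIntegral.integral_const_mul,
    AddCircle.coe_period, AddCircle.coe_zero, sub_self, sub_eq_zero] at h
  rw [mode, mode, fourierCoeff_eq_intervalIntegral _ _ 0, fourierCoeff_eq_intervalIntegral _ _ 0]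
  simpa using h

theorem cosCoeff_sinCoeff {f : Spacetime → ℝ} (hf : IsSmooth f) (k : ℕ) :
    cosCoeff f k = 2 * (mode f k).re ∧ sinCoeff f k = -2 * (mode f k).im := by
  have hc : Continuous fun y : ℝ => f (0, (y : UnitAddCircle)) :=
    (hf.continuous_slice 0).comp (AddCircle.continuous_mk' 1)
  have i1 : IntervalIntegrable (fun y : ℝ => ((f (0, (y : UnitAddCircle)) *
      Real.cos (2 * Real.pi * k * y) : ℝ) : ℂ)) volume 0 1 :=
    (Complex.continuous_ofReal.comp (hc.mul (by fun_prop))).intervalIntegrable _ _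
  have i2 : IntervalIntegrable (fun y : ℝ => Complex.I * ((f (0, (y : UnitAddCircle)) *
      Real.sin (2 * Real.pi * k * y) : ℝ) : ℂ)) volume 0 1 :=
    (continuous_const.mul
      (Complex.continuous_ofReal.comp (hc.mul (by fun_prop)))).intervalIntegrable _ _
  have h : mode f k = ((cosCoeff f k / 2 : ℝ) : ℂ) - Complex.I * ((sinCoeff f k / 2 : ℝ) : ℂ) := by
    rw [mode, fourierCoeff_eq_intervalIntegral _ _ 0, cosCoeff, sinCoeff,
      mul_div_cancel_left₀ _ two_ne_zero, mul_div_cancel_left₀ _ two_ne_zero,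
      ← intervalIntegral.integral_ofReal, ← intervalIntegral.integral_ofReal,
      ← intervalIntegral.integral_const_mul, ← intervalIntegral.integral_sub i1 i2]
    simp only [div_one, one_smul, zero_add]
    refine intervalIntegral.integral_congr fun y _ => ?_
    have e : (2 * Real.pi * Complex.I * ((-(k : ℤ) : ℤ) : ℂ) * y / ((1 : ℝ) : ℂ)) =
        ((-(2 * Real.pi * k * y) : ℝ) : ℂ) * Complex.I := by
      push_cast
      ring
    simp only [smul_eq_mul, fourier_coe_apply, e, Complex.exp_mul_I, ← Complex.ofReal_cos,
      ← Complex.ofReal_sin, Real.cos_neg, Real.sin_neg]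
    push_cast
    ring
  rw [h]
  constructor <;> simp <;> ring

theorem mode_add_sub {f g : Spacetime → ℝ} (hf : IsSmooth f) (hg : IsSmooth g) (n : ℤ) :
    mode (f + g) n = mode f n + mode g n ∧ mode (f - g) n = mode f n - mode g n := by
  have cf := Complex.continuous_ofReal.comp (hf.continuous_slice 0)
  have cg := Complex.continuous_ofReal.comp (hg.continuous_slice 0)
  have e : mode (f - g) n = mode f n - mode g n := by
    rw [mode, mode, mode]
    refine Eq.trans ?_ (fourierCoeff_sub_of_continuous cf cg n)
    simp
  have cfg := Complex.continuous_ofReal.comp ((hf.add hg).continuous_slice 0)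
  have e2 := fourierCoeff_sub_of_continuous cfg cg n
  refine ⟨?_, e⟩
  -- The sum rule is the difference rule for `(f + g) - g`.
  rw [← sub_eq_iff_eq_add, mode, mode, mode]
  refine e2.symm.trans ?_
  simp

/-! ### Right-moving and left-moving modes -/

/-- The Fourier coefficients at time `0` of the derivative of the right-moving part `φ + φ̃` of the
potentials of a one-form. -/
def rightMode (η : dynSector) (n : ℤ) : ℂ :=
  fourierCoeff (fun x => (((η : OneForm) (0, x)).2 - ((η : OneForm) (0, x)).1 : ℂ)) n

/-- The complex conjugates of the Fourier coefficients at time `0` of the derivative of the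
left-moving part `φ - φ̃` of the potentials of a one-form. -/
def leftMode (η : dynSector) (n : ℤ) : ℂ :=
  star (fourierCoeff (fun x => (((η : OneForm) (0, x)).2 + ((η : OneForm) (0, x)).1 : ℂ)) n)

/-- `φ` and `φ̃` have `θ`-derivatives `η_θ` and `-η_t`. Defining the modes by the components of `η`
makes them additive with no choice of potentials; this lemma returns to potentials when needed. -/
theorem rightMode_eq {η : dynSector} {f f' : Spacetime → ℝ} (h : IsPotentialPair f f' η) (n : ℤ) :
    rightMode η n = 2 * Real.pi * Complex.I * n * mode (f + f') n := by
  rw [← mode_partialTheta (h.smooth_left.add h.smooth_right), rightMode, mode]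
  congr 1
  funext x
  have e1 := congrArg Prod.snd (congrFun (h.smooth_left.extD_add h.smooth_right) (0, x))
  have e2 := congrArg Prod.snd (congrFun h.extD_left (0, x))
  have e3 := congrArg Prod.snd (congrFun h.extD_right (0, x))
  simp only [extD, Pi.add_apply, Prod.snd_add, hodge_apply] at e1 e2 e3
  rw [e1, e2, e3]
  push_cast
  ring

theorem star_leftMode_eq {η : dynSector} {f f' : Spacetime → ℝ} (h : IsPotentialPair f f' η)
    (n : ℤ) : star (leftMode η n) = 2 * Real.pi * Complex.I * n * mode (f - f') n := by
  rw [← mode_partialTheta (h.smooth_left.sub h.smooth_right), leftMode, mode, star_star]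
  congr 1
  funext x
  have e1 := congrArg Prod.snd (congrFun (h.smooth_left.extD_sub h.smooth_right) (0, x))
  have e2 := congrArg Prod.snd (congrFun h.extD_left (0, x))
  have e3 := congrArg Prod.snd (congrFun h.extD_right (0, x))
  simp only [extD, Pi.sub_apply, Prod.snd_sub, hodge_apply] at e1 e2 e3
  rw [e1, e2, e3]
  push_cast
  ring

theorem continuous_components (η : dynSector) :
    Continuous (fun x => ((η : OneForm) (0, x)).1) ∧
      Continuous (fun x => ((η : OneForm) (0, x)).2) := by
  have h := isPotentialPair η
  constructor
  · have e : (fun x => ((η : OneForm) (0, x)).1) =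
        fun x => -partialTheta (dualPotential η) (0, x) := by
      funext x
      have e3 := congrArg Prod.snd (congrFun h.extD_right (0, x))
      simp only [extD, hodge_apply] at e3
      rw [e3, neg_neg]
    rw [e]
    exact (h.smooth_right.continuous_partialTheta 0).neg
  · have e : (fun x => ((η : OneForm) (0, x)).2) =
        fun x => partialTheta (potential η) (0, x) := by
      funext x
      exact (congrArg Prod.snd (congrFun h.extD_left (0, x))).symm
    rw [e]
    exact h.smooth_left.continuous_partialTheta 0

theorem rightMode_sub (η θ : dynSector) (n : ℤ) :
    rightMode (η - θ) n = rightMode η n - rightMode θ n := by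
  have c : ∀ η : dynSector, Continuous fun x =>
      (((η : OneForm) (0, x)).2 - ((η : OneForm) (0, x)).1 : ℂ) := fun η => by
    obtain ⟨h1, h2⟩ := continuous_components η
    fun_prop
  rw [rightMode, rightMode, rightMode, ← fourierCoeff_sub_of_continuous (c η) (c θ)]
  congr 1
  funext x
  simp only [Submodule.coe_sub, Pi.sub_apply, Prod.fst_sub, Prod.snd_sub, Complex.ofReal_sub]
  ring

theorem leftMode_sub (η θ : dynSector) (n : ℤ) :
    leftMode (η - θ) n = leftMode η n - leftMode θ n := by
  have c : ∀ η : dynSector, Continuous fun x =>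
      (((η : OneForm) (0, x)).2 + ((η : OneForm) (0, x)).1 : ℂ) := fun η => by
    obtain ⟨h1, h2⟩ := continuous_components η
    fun_prop
  rw [leftMode, leftMode, leftMode, ← star_sub, ← fourierCoeff_sub_of_continuous (c η) (c θ)]
  congr 2
  funext x
  simp only [Submodule.coe_sub, Pi.sub_apply, Prod.fst_sub, Prod.snd_sub, Complex.ofReal_sub]
  ring

/-! ### The forms `μ` and `τ` as series over modes -/

/-- The contribution of the `k`-th modes to the complex inner product. -/
def modeProd (η θ : dynSector) (k : ℤ) : ℂ :=
  star (rightMode η k) * rightMode θ k + star (leftMode η k) * leftMode θ k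

theorem summable_modeProd (η θ : dynSector) : Summable fun k : ℤ => modeProd η θ k := by
  obtain ⟨h1, h2⟩ := continuous_components η
  obtain ⟨k1, k2⟩ := continuous_components θ
  -- Parseval for the derivatives of the two chiral parts; the second series is conjugated because
  -- `leftMode` is.
  have a := (hasSum_star_fourierCoeff_mul (h2.sub h1) (k2.sub k1)).summable
  have b := (hasSum_star_fourierCoeff_mul (h2.add h1) (k2.add k1)).summable.star
  refine (a.add b).congr fun k => ?_
  simp only [modeProd, rightMode, leftMode, star_mul', star_star, Pi.sub_apply, Pi.add_apply,
    Complex.ofReal_sub, Complex.ofReal_add]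

theorem hasSum_pnat_of_int {f : ℤ → ℂ} {a : ℂ} (h : HasSum f a) (h0 : f 0 = 0) :
    HasSum (fun k : ℕ+ => f k + f (-k)) a := by
  -- Summing `f n + f (-n)` over `n ≥ 0` counts `f 0` twice, which is harmless because it vanishes.
  have h1 := h.nat_add_neg
  rw [h0, add_zero] at h1
  refine (PNat.coe_injective.hasSum_iff (f := fun n : ℕ => f n + f (-n)) fun n hn => ?_).2 h1
  obtain rfl : n = 0 := by
    by_contra hne
    exact hn ⟨⟨n, Nat.pos_of_ne_zero hne⟩, rfl⟩
  simp [h0]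

/-- The `k`-th modes are `2πik` times complex combinations of `(a⁻, b⁻)` and `(a⁺, b⁺)`, so the
weight `πk` in `μ` is `(2πk)² / (4πk)`. Convergence must be proved, since a divergent `∑'` would be
`0`. -/
theorem hasSum_mu (η θ : dynSector) :
    HasSum (fun k : ℕ+ => (4 * Real.pi * k)⁻¹ * (modeProd η θ k).re) (mu η θ) := by
  have hs : Summable fun k : ℕ+ => (4 * Real.pi * k)⁻¹ * (modeProd η θ (k : ℕ)).re := by
    have h1 : Summable fun k : ℕ+ => ‖modeProd η θ (k : ℕ)‖ :=
      (summable_modeProd η θ).norm.comp_injective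
        (i := fun k : ℕ+ => ((k : ℕ) : ℤ)) (fun a b h => by simpa using h)
    refine Summable.of_norm_bounded h1 fun k => ?_
    rw [norm_mul]
    have hk : (1 : ℝ) ≤ k := by exact_mod_cast Nat.one_le_iff_ne_zero.2 k.ne_zero
    have h2 : ‖(4 * Real.pi * k : ℝ)⁻¹‖ ≤ 1 := by
      rw [norm_inv, Real.norm_of_nonneg (by positivity)]
      exact inv_le_one_of_one_le₀ (by nlinarith [Real.pi_gt_three])
    exact (mul_le_of_le_one_left (norm_nonneg _) h2).trans (Complex.abs_re_le_norm _)
  convert hs.hasSum using 1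
  rw [mu]
  congr 1
  funext k
  -- Right movers depend on `t - θ` and carry the minus coefficients, left movers the plus ones.
  have key : ∀ η : dynSector,
      rightMode η (k : ℕ) = 2 * Real.pi * Complex.I * ((k : ℕ) : ℤ) *
        -(bMinus η k - aMinus η k * Complex.I : ℂ) ∧
      star (leftMode η (k : ℕ)) = 2 * Real.pi * Complex.I * ((k : ℕ) : ℤ) *
        -(bPlus η k + aPlus η k * Complex.I : ℂ) := fun η => by
    have h := isPotentialPair η
    obtain ⟨c1, s1⟩ := cosCoeff_sinCoeff h.smooth_left k
    obtain ⟨c2, s2⟩ := cosCoeff_sinCoeff h.smooth_right k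
    obtain ⟨m1, m2⟩ := mode_add_sub h.smooth_left h.smooth_right k
    rw [rightMode_eq h, star_leftMode_eq h, m1, m2, aMinus, bMinus, aPlus, bPlus, c1, c2, s1, s2]
    constructor
    · congr 1
      apply Complex.ext <;> simp <;> ring
    · congr 1
      apply Complex.ext <;> simp <;> ring
  obtain ⟨e1, e2⟩ := key η
  obtain ⟨e3, e4⟩ := key θ
  have e2' := congrArg star e2
  have e4' := congrArg star e4
  rw [star_star] at e2' e4'
  rw [modeProd, e1, e3, e2', e4']
  have hk : (k : ℝ) ≠ 0 := by exact_mod_cast k.ne_zero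
  have hp := Real.pi_ne_zero
  simp
  field_simp
  ring

/-- Parseval, with `f_k` replaced by `(∂f)_k / (2πik)`. The modes `k` and `-k` are conjugate, so
together they give twice a real part, and the factor `i` turns it into an imaginary part. The zero
mode drops out because a derivative has mean zero. -/
theorem hasSum_integral_mul_partialTheta {f g : Spacetime → ℝ} (hf : IsSmooth f)
    (hg : IsSmooth g) :
    HasSum (fun k : ℕ+ => -(Real.pi * k)⁻¹ *
      (star (mode (partialTheta f) k) * mode (partialTheta g) k).im)
      (∫ x : UnitAddCircle, f (0, x) * partialTheta g (0, x)) := by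
  have h := hasSum_pnat_of_int
    (hasSum_star_fourierCoeff_mul (hf.continuous_slice 0) (hg.continuous_partialTheta 0)) (by
      have := mode_partialTheta hg 0
      rw [mode] at this
      simp [this])
  have h' := Complex.hasSum_re h
  rw [Complex.ofReal_re] at h'
  convert h' using 1
  funext k
  rw [fourierCoeff_ofReal_neg, fourierCoeff_ofReal_neg]
  change _ = (star (mode f k) * mode (partialTheta g) k +
    star (star (mode f k)) * star (mode (partialTheta g) k)).re
  rw [mode_partialTheta hf]
  have hk : (k : ℝ) ≠ 0 := by exact_mod_cast k.ne_zero
  have hp := Real.pi_ne_zero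
  simp
  field_simp
  ring

theorem hasSum_tauReal (η θ : dynSector) :
    HasSum (fun k : ℕ+ => -(2 * Real.pi * k)⁻¹ * (modeProd η θ k).im) (tauReal η θ) := by
  have h := isPotentialPair η
  have k := isPotentialPair θ
  have a := hasSum_integral_mul_partialTheta (h.smooth_left.add h.smooth_right)
    (k.smooth_left.add k.smooth_right)
  have b := hasSum_integral_mul_partialTheta (h.smooth_left.sub h.smooth_right)
    (k.smooth_left.sub k.smooth_right)
  have hab := (a.sub b).mul_left (1 / 2)
  -- Polarization of the integrand: with `A = φ + φ̃`, `B = φ - φ̃`, one has `A ∂A' - B ∂B' = 2(φ̃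
  -- ∂φ' + φ ∂φ̃')`. The minus sign in front of the left movers is why `leftMode` is conjugated:
  -- conjugation flips the sign of the imaginary part.
  have e : 1 / 2 * ((∫ x : UnitAddCircle, (potential η + dualPotential η) (0, x) *
      partialTheta (potential θ + dualPotential θ) (0, x)) -
      ∫ x : UnitAddCircle, (potential η - dualPotential η) (0, x) *
      partialTheta (potential θ - dualPotential θ) (0, x)) = tauReal η θ := by
    rw [tauReal_eq h k, pairing, ← integral_sub, ← integral_const_mul]
    · congr 1
      funext x
      have e1 := congrArg Prod.snd (congrFun (k.smooth_left.extD_add k.smooth_right) (0, x))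
      have e2 := congrArg Prod.snd (congrFun (k.smooth_left.extD_sub k.smooth_right) (0, x))
      simp only [extD, Pi.sub_apply, Prod.snd_sub, Pi.add_apply, Prod.snd_add] at e1 e2
      rw [e1, e2]
      simp only [Pi.add_apply, Pi.sub_apply]
      ring
    · exact integrable_of_continuous (((h.smooth_left.add h.smooth_right).continuous_slice 0).mul
        ((k.smooth_left.add k.smooth_right).continuous_partialTheta 0))
    · exact integrable_of_continuous (((h.smooth_left.sub h.smooth_right).continuous_slice 0).mul
        ((k.smooth_left.sub k.smooth_right).continuous_partialTheta 0))
  rw [e] at hab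
  convert! hab using 1
  funext n
  have m1 := mode_partialTheta (h.smooth_left.add h.smooth_right) n
  have m2 := mode_partialTheta (k.smooth_left.add k.smooth_right) n
  have m3 := mode_partialTheta (h.smooth_left.sub h.smooth_right) n
  have m4 := mode_partialTheta (k.smooth_left.sub k.smooth_right) n
  rw [← rightMode_eq h] at m1
  rw [← rightMode_eq k] at m2
  rw [← star_leftMode_eq h] at m3
  rw [← star_leftMode_eq k] at m4
  rw [m1, m2, m3, m4, modeProd]
  simp
  field_simp
  ring

/-! ### Polarization and invariance of `μ` -/

theorem mu_sub_self (η θ : dynSector) :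
    mu (η - θ) (η - θ) = mu η η + mu θ θ - 2 * mu θ η := by
  refine (hasSum_mu (η - θ) (η - θ)).unique ?_
  convert! ((hasSum_mu η η).add (hasSum_mu θ θ)).sub ((hasSum_mu θ η).mul_left 2) using 1
  funext k
  simp only [modeProd, rightMode_sub, leftMode_sub]
  simp
  ring

theorem mu_zero : mu 0 0 = 0 := by
  have h := mu_sub_self 0 0
  rw [sub_self] at h
  linarith

/-- On the diagonal only the moduli of the modes enter, so phases and signs of modes are symmetries
of the quadratic form. -/
theorem mu_self_congr {η θ : dynSector}
    (hr : ∀ k, ‖rightMode η k‖ = ‖rightMode θ k‖) (hl : ∀ k, ‖leftMode η k‖ = ‖leftMode θ k‖) :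
    mu η η = mu θ θ := by
  refine (hasSum_mu η η).unique ?_
  convert! hasSum_mu θ θ using 1
  funext k
  simp only [modeProd, RCLike.star_def, Complex.conj_mul', hr, hl]

/-- Swapping `φ` and `φ̃` fixes `φ + φ̃` and negates `φ - φ̃`. -/
theorem mu_duality (η : dynSector) : mu (duality η) (duality η) = mu η η := by
  refine mu_self_congr (fun k => ?_) fun k => ?_
  · congr 1
    rw [rightMode_eq (η := duality η) (isPotentialPair η).dual, rightMode_eq (isPotentialPair η),
      add_comm]
  · rw [← norm_star, star_leftMode_eq (η := duality η) (isPotentialPair η).dual,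
      ← norm_star (leftMode η k), star_leftMode_eq (isPotentialPair η),
      (mode_add_sub (isPotentialPair η).smooth_left (isPotentialPair η).smooth_right k).2,
      (mode_add_sub (isPotentialPair η).smooth_right (isPotentialPair η).smooth_left k).2,
      norm_mul, norm_mul _ (mode _ _ - _), norm_sub_rev]

/-- By the wave equation each chiral part is transported along its light ray, so at time zero the
translation by `(s, φ)` is the rotation by `φ - s` for right movers and by `φ + s` for left movers.
-/
theorem mu_translate (v : Spacetime) (η : dynSector) :
    mu (translate v η) (translate v η) = mu η η := by
  obtain ⟨s, φ⟩ := v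
  have h := isPotentialPair η
  have hn : ∀ (f : Spacetime → ℝ) (c : UnitAddCircle) (k : ℤ),
      ‖fourierCoeff (fun x => (f (0, x + c) : ℂ)) k‖ = ‖mode f k‖ := fun f c k => by
    rw [fourierCoeff_comp_add (fun x => (f (0, x) : ℂ)), norm_mul, fourier_apply, Circle.norm_coe,
      one_mul, mode]
  refine mu_self_congr (fun k => ?_) fun k => ?_
  · rw [rightMode_eq (η := translate (s, φ) η) (h.comp_add (s, φ)), rightMode_eq h, norm_mul,
      norm_mul _ (mode _ _), ← hn (potential η + dualPotential η) (φ - (s : UnitAddCircle))]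
    congr 2
    rw [mode]
    congr 1
    funext x
    have := h.add_slice s (x + φ)
    simp only [Pi.add_apply, Prod.mk_add_mk, zero_add, ← add_sub_assoc, this]
  · rw [← norm_star, star_leftMode_eq (η := translate (s, φ) η) (h.comp_add (s, φ)),
      ← norm_star (leftMode η k), star_leftMode_eq h, norm_mul,
      norm_mul _ (mode _ _), ← hn (potential η - dualPotential η) (φ + (s : UnitAddCircle))]
    congr 2
    rw [mode]
    congr 1
    funext x
    have := h.sub_slice s (x + φ)
    simp only [Pi.sub_apply, Prod.mk_add_mk, zero_add, ← add_assoc, this]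

/-! ### Positivity and the Gaussian state -/

/-- For `r ≥ 4π|κ|` the sesquilinear form `r μ - 2πi κ τ` is positive. -/
theorem posSemidef_kernel {κ r : ℝ} (hr : 4 * Real.pi * |κ| ≤ r) :
    (Matrix.of fun η θ : dynSector =>
      ((r * mu η θ : ℝ) : ℂ) - 2 * Real.pi * Complex.I * (κ * tauReal η θ : ℝ)).PosSemidef := by
  have h₁ : 4 * Real.pi * κ ≤ r :=
    (mul_le_mul_of_nonneg_left (le_abs_self κ) (by positivity)).trans hr
  have h₂ : 4 * Real.pi * -κ ≤ r :=
    (mul_le_mul_of_nonneg_left (neg_le_abs κ) (by positivity)).trans hr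
  have hp : 0 ≤ (r + 4 * Real.pi * κ) / 2 := by linarith
  have hq : 0 ≤ (r - 4 * Real.pi * κ) / 2 := by linarith
  -- The kernel `z_k`, a sum of two Gram matrices. Being Hermitian, it has its entrywise conjugate
  -- as transpose.
  let A (k : ℕ+) : Matrix dynSector dynSector ℂ :=
    (Matrix.of fun η θ => star (rightMode η k) * rightMode θ k) +
      Matrix.of fun η θ => star (leftMode η k) * leftMode θ k
  have hA : ∀ k, (A k).PosSemidef := fun k =>
    (Matrix.PosSemidef.star_mul_self _).add (Matrix.PosSemidef.star_mul_self _)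
  -- `r Re z + 4πκ i Im z` is split along `z` and its conjugate; the nonnegative coefficients are
  -- `hp` and `hq`.
  refine Matrix.PosSemidef.of_hasSum (A := fun k : ℕ+ => (4 * Real.pi * k : ℝ)⁻¹ •
    (((r + 4 * Real.pi * κ) / 2) • A k + ((r - 4 * Real.pi * κ) / 2) • (A k)ᵀ))
    (fun k => (((hA k).smul hp).add ((hA k).transpose.smul hq)).smul (by positivity))
    fun η θ => ?_
  have h1 := (Complex.hasSum_ofReal.2 (hasSum_mu η θ)).mul_left (r : ℂ)
  have h2 := (Complex.hasSum_ofReal.2 (hasSum_tauReal η θ)).mul_left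
    (2 * Real.pi * Complex.I * κ : ℂ)
  convert! h1.sub h2 using 1
  · funext k
    have e : A k η θ = modeProd η θ k := rfl
    have e' : (A k)ᵀ η θ = star (modeProd η θ k) := by
      rw [← e, (hA k).isHermitian.apply, Matrix.transpose_apply]
    rw [Matrix.smul_apply, Matrix.add_apply, Matrix.smul_apply, Matrix.smul_apply, e, e']
    have hk : (k : ℝ) ≠ 0 := by exact_mod_cast k.ne_zero
    have hp := Real.pi_ne_zero
    apply Complex.ext <;> simp <;> field_simp <;> ring
  · simp
    ring

theorem phase_tau (κ : ℝ) (η θ : dynSector) :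
    (tau κ).phase η θ = Complex.exp (2 * Real.pi * Complex.I * (κ * tauReal η θ : ℝ)) := by
  rw [PresymplecticForm.phase, tau_apply, AddCircle.toCircle_apply_mk, Circle.coe_exp]
  congr 1
  push_cast
  ring

/-- The state `W(η) ↦ exp (- (r / 2) μ(η, η))` on the span of the Weyl elements. -/
theorem isState_lift_gaussian {κ r : ℝ} (hr : 4 * Real.pi * |κ| ≤ r) :
    IsState (WeylAlg.lift fun η => (Real.exp (-(r / 2) * mu η η) : ℂ) :
      WeylAlg (tau κ) →ₗ[ℂ] ℂ) := by
  refine WeylAlg.isState_lift (by simp [mu_zero]) ?_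
  -- Polarizing `μ(θ - η, θ - η)` separates the diagonal terms, which form a rank-one Gram matrix,
  -- from the exponential of the positive kernel.
  convert! (Matrix.PosSemidef.star_mul_self
    (fun η : dynSector => (Real.exp (-(r / 2) * mu η η) : ℂ))).hadamard
    (posSemidef_kernel hr).map_exp using 1
  ext η θ
  simp only [Matrix.of_apply, Matrix.hadamard_apply, Matrix.map_apply, phase_tau, mu_sub_self,
    RCLike.star_def, Complex.conj_ofReal, map_neg, LinearMap.neg_apply]
  simp only [Complex.ofReal_exp, ← Complex.exp_add]
  congr 1
  push_cast
  ring

theorem IsOmegaMu.unique {κ r : ℝ} {ω ω' : DynAlgebra κ →ₗ[ℂ] ℂ} (h : IsOmegaMu κ r ω)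
    (h' : IsOmegaMu κ r ω') : ω = ω' :=
  CCR.linearMap_ext h.isState.continuous h'.isState.continuous fun η => by
    rw [h.apply_W, h'.apply_W]

theorem existsUnique_isOmegaMu {κ r : ℝ} (hr : 4 * Real.pi * |κ| ≤ r) :
    ∃! ω : DynAlgebra κ →ₗ[ℂ] ℂ, IsOmegaMu κ r ω := by
  obtain ⟨ω, hω, h⟩ := CCR.exists_isState_extension (isState_lift_gaussian hr)
  have hω' : IsOmegaMu κ r ω := ⟨hω, fun η => (h _).trans (WeylAlg.lift_W _ η)⟩
  exact ⟨ω, hω', fun _ h' => h'.unique hω'⟩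

/-- The composite of the state with the automorphism has the same values on Weyl elements, so
uniqueness identifies the two. -/
theorem IsOmegaMu.apply_equiv {κ r : ℝ} {ω : DynAlgebra κ →ₗ[ℂ] ℂ} (h : IsOmegaMu κ r ω)
    (ψ : dynSector ≃+ dynSector)
    (hψ : ∀ η θ, (tau κ).toHom (ψ η) (ψ θ) = (tau κ).toHom η θ)
    (hμ : ∀ η, mu (ψ η) (ψ η) = mu η η) (a : DynAlgebra κ) :
    ω (CCR.equiv ψ hψ a) = ω a := by
  have h' : IsOmegaMu κ r
      (ω ∘ₗ (CCR.equiv ψ hψ : DynAlgebra κ →⋆ₐ[ℂ] DynAlgebra κ).toAlgHom.toLinearMap) :=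
    ⟨h.isState.comp_starAlgEquiv _, fun η => by
      refine (congrArg ω (CCR.equiv_W ψ hψ η)).trans ?_
      rw [h.apply_W, hμ]⟩
  exact LinearMap.congr_fun (h'.unique h) a

end Cylinder

/-! ### Group law and commutation of the implementers -/

/-- Isomorphisms of pre-symplectic groups compose to isomorphisms of the C⋆-algebras. -/
theorem CCR.equiv_equiv {G : Type*} [AddCommGroup G] {τ : PresymplecticForm G} {ψ χ ρ : G ≃+ G}
    (hψ : ∀ x y, τ.toHom (ψ x) (ψ y) = τ.toHom x y)
    (hχ : ∀ x y, τ.toHom (χ x) (χ y) = τ.toHom x y)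
    (hρ : ∀ x y, τ.toHom (ρ x) (ρ y) = τ.toHom x y)
    (h : ∀ x, ψ (χ x) = ρ x) (a : CCR τ) :
    CCR.equiv ψ hψ (CCR.equiv χ hχ a) = CCR.equiv ρ hρ a := by
  have hc : ∀ (ψ : G ≃+ G) (hψ : ∀ x y, τ.toHom (ψ x) (ψ y) = τ.toHom x y),
      Continuous (CCR.equiv ψ hψ : CCR τ → CCR τ) := fun ψ hψ =>
    CCR.continuous_map (ψ : G →+ G) hψ
  let L (ψ : G ≃+ G) (hψ : ∀ x y, τ.toHom (ψ x) (ψ y) = τ.toHom x y) : CCR τ →ₗ[ℂ] CCR τ :=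
    (CCR.equiv ψ hψ : CCR τ →⋆ₐ[ℂ] CCR τ).toAlgHom.toLinearMap
  refine LinearMap.congr_fun (CCR.linearMap_ext (f := L ψ hψ ∘ₗ L χ hχ) (g := L ρ hρ)
    ((hc ψ hψ).comp (hc χ hχ)) (hc ρ hρ) fun x => ?_) a
  change CCR.equiv ψ hψ (CCR.equiv χ hχ (CCR.W τ x)) = CCR.equiv ρ hρ (CCR.W τ x)
  rw [CCR.equiv_W, CCR.equiv_W, CCR.equiv_W, h]

end

theorem mainTheorem8 (κ r : ℝ) (hr : 4 * Real.pi * |κ| ≤ r) :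
    (∃! ω : Cylinder.DynAlgebra κ →ₗ[ℂ] ℂ, Cylinder.IsOmegaMu κ r ω) ∧
    ∀ ω : Cylinder.DynAlgebra κ →ₗ[ℂ] ℂ, Cylinder.IsOmegaMu κ r ω →
      ∀ (H : Type*) [NormedAddCommGroup H] [InnerProductSpace ℂ H] [CompleteSpace H]
        (π : Cylinder.DynAlgebra κ →⋆ₐ[ℂ] (H →L[ℂ] H)) (Ψ : H), IsGNSTriple ω π Ψ →
        ∃ (V : H ≃ₗᵢ[ℂ] H) (U : Multiplicative Cylinder.Spacetime →* (H ≃ₗᵢ[ℂ] H)),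
          Implements π Ψ (Cylinder.dualityAut κ) V ∧
          (∀ v : Cylinder.Spacetime,
            Implements π Ψ (Cylinder.symmetryAut κ v) (U (Multiplicative.ofAdd v))) ∧
          ∀ v : Cylinder.Spacetime, Commute V (U (Multiplicative.ofAdd v)) := by
  refine ⟨Cylinder.existsUnique_isOmegaMu hr, fun ω hω H _ _ _ π Ψ hπ => ?_⟩
  obtain ⟨V, hV⟩ := hπ.exists_implements (Cylinder.dualityAut κ)
    (hω.apply_equiv _ _ Cylinder.mu_duality)
  choose U hU using fun v => hπ.exists_implements (Cylinder.symmetryAut κ v)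
    (hω.apply_equiv _ _ (Cylinder.mu_translate v))
  -- The operators `U v` were chosen independently; uniqueness of implementers forces the group law.
  have hUU : ∀ v w, U (v + w) = U v * U w := fun v w =>
    hπ.implements_unique (hU (v + w)) ((hU v).mul (hU w) (CCR.equiv_equiv _ _ _ fun η =>
      Subtype.ext (funext fun p => congrArg (η : Cylinder.OneForm) (add_assoc p v w))))
  refine ⟨V, MonoidHom.mk' (fun v => U v.toAdd) fun v w => hUU _ _, hV, hU, fun v => ?_⟩
  -- `U V` and `V U` implement the same automorphism, because the Hodge operator acts pointwise and
  -- so commutes with translations.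
  have h1 := (hU v).mul hV (γ := (Cylinder.dualityAut κ).trans (Cylinder.symmetryAut κ v))
    fun a => rfl
  refine hπ.implements_unique (hV.mul (hU v) fun a => ?_) h1
  refine (CCR.equiv_equiv (ρ := Cylinder.duality.trans (Cylinder.translate v))
    _ _ (fun η θ => ?_) (fun η => rfl) a).trans (CCR.equiv_equiv _ _ _ (fun η => rfl) a).symm
  exact (Cylinder.tau_translate κ v _ _).trans (Cylinder.tau_duality κ η θ)
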